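/- Corollary (Dichotomy). Let $q(\vec h) \,\text{:-}\, g_1,\dots,g_m$ ($m\ge 1$) be a self-join-free conjunctive query: each subgoal $g_i=R_i(\dots)$ is a relational atom with variables and constants, the relations $R_1,\dots,R_m$ are distinct, and $\vec h$ are the head variables, each occurring in some subgoal. The other variables are existential. Let schema knowledge be given: a set of deterministic relations, and a set $\Gamma$ of functional dependencies $\vec y\to\vec z$, each holding on one relation $R_i$ with $\vec y,\vec z\subseteq \mathrm{Var}(g_i)$. *Databases.* A tuple-independent probabilistic database over an infinite domain of constants is a finite set of tuples with independent probabilities in $[0,1]$. It conforms to the schema if all tuples of deterministic relations have probability $1$ and the tables satisfy the functional dependencies. The reliability $r(q)$ (for a given answer) is the probability that $q$ is true in a random possible world. *Plans.* A query plan is built from the atoms $R_i$, projections $\pi_{\vec x}P$ with duplicate elimination ($\vec x\subseteq \mathrm{HVar}(P)$), and joins $\bowtie(P_1,\dots,P_k)$ of $k\ge 2$ unordered subplans; joins and projections alternate. Here $\mathrm{HVar}(R_i)=\mathrm{Var}(g_i)$, $\mathrm{HVar}(\pi_{\vec x}P)=\vec x$, and $\mathrm{HVar}$ of a join is the union of those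 of its subplans. A plan for $q$ mentions each subgoal exactly once, has $\mathrm{HVar}(P)=\vec h$, projects no variable away more than once and projects no head variable away. Write $\pi_{-\vec y}P$ for $\pi_{\mathrm{HVar}(P)\setminus \vec y}P$. A plan is evaluated extensionally, giving each output tuple a score: a join multiplies the scores $p_i$ of the joined tuples, and a projection assigns $1-\prod_i(1-p_i)$ to the tuples with the same projection; tuples that are absent from the output have score $0$. *Safety.* The query is *safe* for the given schema knowledge if it can be evaluated with a query plan, i.e. if there is a plan $P$ for $q$ whose score equals the reliability of $q$, for every answer and over every probabilistic database that conforms to the schema. *Algorithm 3.* First, as long as possible: if $\vec y\to\vec z$ is in $\Gamma$ and every variable of $\vec y$ occurs in the (already dissociated) atom $R_i$ or is a head variable of $q$, add the variables $\vec z$ to $R_i$. Then call $\mathrm{DP}$ on the resulting query. For a query with head variables $H$, atoms with their current variables, and existential variables those not in $H$, call it connected if its atoms are connected by shared existential variables. A top set is an inclusion-minimal set of existential variables that disconnects the query when moved to the head. Let $\vec s$ be the set of separator variables, i.e. the existential variables that occur in all non-deterministic atoms. $\mathrm{DP}$ returns a set of plans: - if there is a single atom $R_i$: the plan $\pi_H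 R_i$; - otherwise, if the query is disconnected: all joins of plans $P_c\in \mathrm{DP}(c)$, one for each connected component $c$, where $c$ has head variables $H\cap \mathrm{Var}(c)$; - otherwise, if $\vec s\ne\emptyset$ and moving $\vec s$ to the head disconnects the query: all $\pi_{-\vec s}P$ with $P\in\mathrm{DP}$ of the query with head $H\cup\vec s$; - otherwise, if $\vec s\neq\emptyset$: all $\pi_{-(\vec s\cup\vec y)}P$, where $\vec y$ is a top set of the query with head $H\cup\vec s$ and $P\in\mathrm{DP}$ of the query with head $H\cup\vec s\cup\vec y$; - otherwise: all $\pi_{-\vec y}P$, where $\vec y$ is a top set and $P\in\mathrm{DP}$ of the query with head $H\cup\vec y$. Then $q$ is safe for the given schema knowledge if and only if Algorithm 3 returns exactly one plan. -/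

import Mathlib

/-!
Self-join-free conjunctive queries over tuple-independent probabilistic databases, query plans with
their extensional semantics, and the plan enumeration that takes deterministic relations and
functional dependencies into account.

Types: `ι` indexes the subgoals (equivalently, since there are no self-joins, the relation symbols),
`V` is the type of variables and `D` is the domain of constants.
-/

noncomputable section

open scoped Classical

namespace Dissociation

/-- A self-join-free conjunctive query `q(head) :- g_i (i : ι)`. The subgoal `g_i` is
`R_i(args i 0, …, args i (arity i - 1))`; its arguments are variables (`Sum.inl`) or constants
(`Sum.inr`), possibly repeated. Different subgoals use different relation symbols. -/
structure SJFQuery (ι V D : Type*) where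
  arity : ι → ℕ
  args : (i : ι) → Fin (arity i) → V ⊕ D
  head : Finset V
  head_occurs : ∀ x ∈ head, ∃ i k, args i k = Sum.inl x

/-- A query plan over the relation symbols `ι`: a relational atom, a projection *onto* `X` with
duplicate elimination, or a join. Every relation symbol occurs once in a plan for a self-join-free
query, so that the subplans of a join mention pairwise disjoint sets of relation symbols. The join is
therefore given by the finite collection `cs` of these sets together with the subplan `f c` that
mentions the symbols in `c`; in this way the order of the subplans is not part of the plan. -/
inductive Plan (ι V : Type*) where
  | atom (i : ι) : Plan ι V
  | proj (X : Finset V) (P : Plan ι V) : Plan ι V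
  | join (cs : Finset (Finset ι)) (f : {c // c ∈ cs} → Plan ι V) : Plan ι V

namespace Plan

variable {ι V : Type*}

/-- The relation symbols mentioned in a plan. -/
def rels : Plan ι V → Finset ι
  | atom i => {i}
  | proj _ P => P.rels
  | join cs f => cs.attach.biUnion fun c => (f c).rels

/-- The head variables of a plan, where `vs i` is the set of variables of the `i`-th atom. -/
def hvar (vs : ι → Finset V) : Plan ι V → Finset V
  | atom i => vs i
  | proj X _ => X
  | join cs f => cs.attach.biUnion fun c => (f c).hvar vs

/-- The project-away operator: project the variables `Y` away. -/
def away (vs : ι → Finset V) (Y : Finset V) (P : Plan ι V) : Plan ι V :=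
  proj (P.hvar vs \ Y) P

/-- The number of projections in the plan that project the variable `y` away. -/
def awayCount (vs : ι → Finset V) (y : V) : Plan ι V → ℕ
  | atom _ => 0
  | proj X P => P.awayCount vs y + if y ∈ P.hvar vs \ X then 1 else 0
  | join cs f => ∑ c ∈ cs.attach, (f c).awayCount vs y

def IsProj : Plan ι V → Prop
  | proj _ _ => True
  | _ => False

def IsJoin : Plan ι V → Prop
  | join _ _ => True
  | _ => False

/-- Syntactic well-formedness: a projection is onto head variables of its subplan, a join has at
least two subplans, and joins and projections alternate. -/
def WellFormed (vs : ι → Finset V) : Plan ι V → Prop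
  | atom _ => True
  | proj X P => X ⊆ P.hvar vs ∧ ¬ P.IsProj ∧ P.WellFormed vs
  | join cs f => 2 ≤ cs.card ∧ (∀ c ∈ cs, ∀ d ∈ cs, c ≠ d → Disjoint c d) ∧
      ∀ c, (f c).rels = c.1 ∧ ¬ (f c).IsJoin ∧ (f c).WellFormed vs

end Plan

namespace SJFQuery

variable {ι V D : Type*}

/-- `Var(g_i)`, the set of variables of the `i`-th subgoal. -/
def vars (q : SJFQuery ι V D) (i : ι) : Finset V :=
  Finset.univ.biUnion fun k => Sum.elim (fun x => {x}) (fun _ => ∅) (q.args i k)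

/-- A tuple, tagged with the relation to which it belongs. -/
abbrev Tuple (q : SJFQuery ι V D) : Type _ := Σ i : ι, (Fin (q.arity i) → D)

/-- The tuple of `R_i` that the `i`-th subgoal requires under the valuation `θ`. -/
def ground (q : SJFQuery ι V D) (i : ι) (θ : V → D) : q.Tuple :=
  ⟨i, fun k => Sum.elim θ id (q.args i k)⟩

/-- A tuple-independent probabilistic database: finitely many possible tuples with probabilities. -/
structure Database (q : SJFQuery ι V D) where
  tuples : Finset q.Tuple
  prob : q.Tuple → ℝ
  prob_nonneg : ∀ t ∈ tuples, 0 ≤ prob t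
  prob_le_one : ∀ t ∈ tuples, prob t ≤ 1

/-- Schema knowledge: the set of deterministic relations, and for every relation `R_i` a set of
functional dependencies `Y → Z`, written as pairs `(Y, Z)` of sets of variables of `g_i`. -/
structure Schema (q : SJFQuery ι V D) where
  det : Set ι
  fds : ι → Set (Finset V × Finset V)
  fds_left : ∀ i, ∀ Γ ∈ fds i, Γ.1 ⊆ q.vars i
  fds_right : ∀ i, ∀ Γ ∈ fds i, Γ.2 ⊆ q.vars i

namespace Database

variable {q : SJFQuery ι V D}

/-- The active domain. -/
def adom (B : q.Database) : Finset D :=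
  B.tuples.biUnion fun t => Finset.univ.image t.2

/-- All tuples of deterministic relations have probability `1`, and the functional dependencies
hold in the tables (read through the variables of the subgoals). -/
def Conforms (B : q.Database) (σ : q.Schema) : Prop :=
  (∀ t ∈ B.tuples, t.1 ∈ σ.det → B.prob t = 1) ∧
  ∀ i, ∀ Γ ∈ σ.fds i, ∀ θ θ' : V → D, q.ground i θ ∈ B.tuples → q.ground i θ' ∈ B.tuples →
    (∀ y ∈ Γ.1, θ y = θ' y) → ∀ z ∈ Γ.2, θ z = θ' z

/-- The probability of the possible world `W ⊆ B.tuples`. -/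
def worldProb (B : q.Database) (W : Finset q.Tuple) : ℝ :=
  (∏ t ∈ W, B.prob t) * ∏ t ∈ B.tuples \ W, (1 - B.prob t)

end Database

/-- In the world `W`, the query is true for the answer in which each head variable `x` has the
value `a x`. -/
def Holds (q : SJFQuery ι V D) (a : V → D) (W : Finset q.Tuple) : Prop :=
  ∃ θ : V → D, (∀ x ∈ q.head, θ x = a x) ∧ ∀ i, q.ground i θ ∈ W

/-- The query reliability `r(q)` (for the answer `a`; if the query is Boolean, then `a` plays no
role): the probability that the query is true in a random possible world. -/
def reliability (q : SJFQuery ι V D) (B : q.Database) (a : V → D) : ℝ :=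
  ∑ W ∈ B.tuples.powerset with q.Holds a W, B.worldProb W

/-- Extensional semantics of plans: `score B P θ` is the probability attribute of the tuple
`(θ x)_{x ∈ hvar P}` in the intermediate relation returned by `P`, and `0` if the tuple is absent
from that relation. A join multiplies; a projection combines all tuples of the subplan with the
same projection by the independent-or. -/
def score (q : SJFQuery ι V D) (B : q.Database) : Plan ι V → (V → D) → ℝ
  | .atom i, θ => if q.ground i θ ∈ B.tuples then B.prob (q.ground i θ) else 0
  | .proj X P, θ =>
      1 - ∏ u ∈ Fintype.piFinset fun _ : {x // x ∈ P.hvar q.vars \ X} => B.adom,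
        (1 - q.score B P (Function.updateFinset θ (P.hvar q.vars \ X) u))
  | .join cs f, θ => ∏ c ∈ cs.attach, q.score B (f c) θ

/-- `P` is a plan for `q`: it is well-formed, mentions every subgoal of `q`, has the head variables
of `q`, projects no variable away more than once, and projects no head variable of `q` away. -/
structure IsPlan [Fintype ι] (q : SJFQuery ι V D) (P : Plan ι V) : Prop where
  wellFormed : P.WellFormed q.vars
  rels_eq : P.rels = Finset.univ
  hvar_eq : P.hvar q.vars = q.head
  away_le_one : ∀ y, P.awayCount q.vars y ≤ 1
  away_head : ∀ y ∈ q.head, P.awayCount q.vars y = 0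

/-- A query is safe for the given schema knowledge if it can be evaluated with a query plan: some
plan for the query calculates the query reliability correctly (for every answer) over every
probabilistic database that conforms to the schema. -/
def IsSafe [Fintype ι] (q : SJFQuery ι V D) (σ : q.Schema) : Prop :=
  ∃ P : Plan ι V, q.IsPlan P ∧
    ∀ B : q.Database, B.Conforms σ → ∀ a : V → D, q.score B P a = q.reliability B a

end SJFQuery

/-! ### Notions on incidence matrices

Below, a subquery is given by the variables `vs i` of the (possibly dissociated) atoms, the set `S`
of its atoms, and the set `H` of its head variables. -/

section Incidence

variable {ι V : Type*} (vs : ι → Finset V)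

/-- All variables of the subquery. -/
def varsOf (S : Finset ι) : Finset V := S.biUnion vs

/-- The existential variables of the subquery. -/
def evar (S : Finset ι) (H : Finset V) : Finset V := varsOf vs S \ H

/-- Two atoms of the subquery share an existential variable. -/
def Linked (S : Finset ι) (H : Finset V) (i j : ι) : Prop :=
  i ∈ S ∧ j ∈ S ∧ ((vs i ∩ vs j) \ H).Nonempty

/-- The subquery is connected by its existential variables. -/
def Connected (S : Finset ι) (H : Finset V) : Prop :=
  ∀ i ∈ S, ∀ j ∈ S, Relation.ReflTransGen (Linked vs S H) i j

/-- The components of the subquery that are connected by its existential variables. -/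
def components (S : Finset ι) (H : Finset V) : Finset (Finset ι) :=
  S.image fun i => S.filter fun j => Relation.ReflTransGen (Linked vs S H) i j

/-- `Y` is a top set: a minimal set of existential variables whose removal (that is, whose move to
the head variables) disconnects the subquery. -/
def IsTopSet (S : Finset ι) (H Y : Finset V) : Prop :=
  Y ⊆ evar vs S H ∧ ¬ Connected vs S (H ∪ Y) ∧ ∀ Y', Y' ⊂ Y → Connected vs S (H ∪ Y')

/-- The separator variables: the existential variables that occur in all probabilistic atoms. -/
def sepVar (det : Set ι) (S : Finset ι) (H : Finset V) : Finset V :=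
  (evar vs S H).filter fun x => ∀ i ∈ S, i ∉ det → x ∈ vs i

/-- The recursive plan enumeration for deterministic relations `det`: `DP vs det S H P` says that
the plan `P` belongs to the set that the recursion returns on the subquery `S`, `H`. There is one
constructor for each way in which the recursion adds a plan to the returned set. -/
inductive DP (det : Set ι) : Finset ι → Finset V → Plan ι V → Prop
  | single (i : ι) (H : Finset V) : DP det {i} H (.proj H (.atom i))
  | disconnected (S : Finset ι) (H : Finset V)
      (f : {c // c ∈ components vs S H} → Plan ι V)
      (hS : 2 ≤ S.card) (hd : ¬ Connected vs S H)
      (hf : ∀ c, DP det c.1 (H ∩ varsOf vs c.1) (f c)) :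
      DP det S H (.join (components vs S H) f)
  | separator (S : Finset ι) (H : Finset V) (P : Plan ι V)
      (hS : 2 ≤ S.card) (hc : Connected vs S H)
      (hz : sepVar vs det S H ≠ ∅)
      (hd : ¬ Connected vs S (H ∪ sepVar vs det S H))
      (hP : DP det S (H ∪ sepVar vs det S H) P) :
      DP det S H (P.away vs (sepVar vs det S H))
  | separatorTop (S : Finset ι) (H Y : Finset V) (P : Plan ι V)
      (hS : 2 ≤ S.card) (hc : Connected vs S H)
      (hz : sepVar vs det S H ≠ ∅)
      (hc' : Connected vs S (H ∪ sepVar vs det S H))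
      (hY : IsTopSet vs S (H ∪ sepVar vs det S H) Y)
      (hP : DP det S (H ∪ sepVar vs det S H ∪ Y) P) :
      DP det S H (P.away vs (sepVar vs det S H ∪ Y))
  | top (S : Finset ι) (H Y : Finset V) (P : Plan ι V)
      (hS : 2 ≤ S.card) (hc : Connected vs S H)
      (hz : sepVar vs det S H = ∅)
      (hY : IsTopSet vs S H Y)
      (hP : DP det S (H ∪ Y) P) :
      DP det S H (P.away vs Y)

end Incidence

namespace SJFQuery

variable {ι V D : Type*}

/-- The variables that `R_i` contains after exhaustive dissociation on the functional dependencies: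
whenever `Y → Z` is a functional dependency (of any relation) and all variables of `Y` are in `R_i`
or are head variables of the query (which act as constants), then `R_i` is dissociated on `Z`. -/
inductive FDVar (q : SJFQuery ι V D) (σ : q.Schema) (i : ι) : V → Prop
  | base (x : V) (hx : x ∈ q.vars i) : FDVar q σ i x
  | step (j : ι) (Γ : Finset V × Finset V) (hΓ : Γ ∈ σ.fds j)
      (hY : ∀ y ∈ Γ.1, y ∉ q.head → FDVar q σ i y) (z : V) (hz : z ∈ Γ.2) : FDVar q σ i z

variable [Fintype ι]

/-- The atoms of the query dissociated on the functional dependencies. -/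
def fdVars (q : SJFQuery ι V D) (σ : q.Schema) (i : ι) : Finset V :=
  (varsOf q.vars Finset.univ).filter (q.FDVar σ i)

/-- The set of plans returned by the plan enumeration with functional dependencies and
deterministic relations: dissociate on the functional dependencies, then call `DP`. -/
def plansFP (q : SJFQuery ι V D) (σ : q.Schema) : Set (Plan ι V) :=
  {P | DP (q.fdVars σ) σ.det Finset.univ q.head P}

end SJFQuery

end Dissociation

end

/-! The enumeration always returns a plan (`exists_DP`), so the question is whether it ever
branches. It branches only at top sets. When one is chosen, no remaining existential variable lies
in all atoms, so a second top set exists (`exists_isTopSet_ne`). The head variables of the subplan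
reveal the choice (`DP.hvar_eq`), so the resulting plans differ.

If the enumeration returns one plan, its recursion thus uses only single atoms, joins of components
and projections on separator variables. The same recursion is carried out with the original,
undissociated atoms and is exact (`exists_evaluates`). Components use different relations, hence are
independent (`Evaluates.join`). For a projection, the separator values of a grounding are functions
of any probabilistic tuple in it and of the head values (`eq_of_fdVar`). Different values therefore
use disjoint sets of probabilistic tuples, while deterministic tuples are certain
(`Evaluates.eventProb_holdsOn_eq`).

Conversely, let some plan be exact. For a probabilistic atom `i`, let A be the set of variables
determined by `i` and the head. Consider a database of two groundings that agree exactly on A, with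
one coin flip in relation `i`. If a projection above `i` acted on a subplan with a head variable
outside A, that coin would be counted twice somewhere: the score would be at least 3/4, the
reliability at most 1/2 (`within_of_exact`). Now take any subquery of the recursion with at least
two atoms, and the lowest join of the exact plan above all of them. A dissociated variable shared by
both sides of this join is determined by every probabilistic atom of the subquery (`exists_split`),
hence is a head or separator variable. So the separator variables disconnect the subquery
(`not_connected_sepVar`), and top sets are never used (`DP.unique`). -/

noncomputable section

open scoped Classical

namespace Dissociation

/-! ### Connectivity and components of subqueries -/

section Incidence

variable {ι V : Type*} {vs : ι → Finset V} {S : Finset ι} {H H' : Finset V}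

theorem mem_varsOf {x : V} : x ∈ varsOf vs S ↔ ∃ i ∈ S, x ∈ vs i := by
  simp [varsOf]

theorem varsOf_mono {S' : Finset ι} (h : S ⊆ S') : varsOf vs S ⊆ varsOf vs S' :=
  Finset.biUnion_subset_biUnion_of_subset_left _ h

theorem Linked.symm {i j : ι} (h : Linked vs S H i j) : Linked vs S H j i :=
  ⟨h.2.1, h.1, by rw [Finset.inter_comm]; exact h.2.2⟩

theorem reflTransGen_linked_symm {i j : ι} (h : Relation.ReflTransGen (Linked vs S H) i j) :
    Relation.ReflTransGen (Linked vs S H) j i := by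
  induction h with
  | refl => exact .refl
  | tail _ hl ih => exact ih.head hl.symm

theorem Linked.anti (h : H ⊆ H') {i j : ι} (hl : Linked vs S H' i j) : Linked vs S H i j :=
  ⟨hl.1, hl.2.1, hl.2.2.mono (Finset.sdiff_subset_sdiff (Finset.Subset.refl _) h)⟩

theorem Connected.anti (h : H ⊆ H') (hc : Connected vs S H') : Connected vs S H :=
  fun i hi j hj => Relation.ReflTransGen.mono (fun _ _ hl => hl.anti h) _ _ (hc i hi j hj)

theorem connected_singleton (i : ι) : Connected vs {i} H := by
  intro a ha b hb
  rw [Finset.mem_singleton] at ha hb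
  subst ha hb
  exact .refl

/-- If all links of a subquery stay inside `T` or outside `T`, then the subquery is disconnected
by `T`. -/
theorem not_connected_of_split {T : Finset ι} {i j : ι} (hi : i ∈ S) (hiT : i ∈ T) (hj : j ∈ S)
    (hjT : j ∉ T) (h : ∀ a ∈ S, a ∈ T → ∀ b ∈ S, b ∉ T → vs a ∩ vs b ⊆ H) :
    ¬ Connected vs S H := by
  intro hc
  have key : ∀ b, Relation.ReflTransGen (Linked vs S H) i b → b ∈ T := by
    intro b hb
    induction hb with
    | refl => exact hiT
    | tail _ hl ih =>
      by_contra hn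
      obtain ⟨x, hx⟩ := hl.2.2
      rw [Finset.mem_sdiff] at hx
      exact hx.2 (h _ hl.1 ih _ hl.2.1 hn hx.1)
  exact hjT (key j (hc i hi j hj))

/-- An atom without existential variables has no links to other atoms. -/
theorem not_connected_of_subset {i : ι} (hS : 2 ≤ S.card) (hi : i ∈ S) (h : vs i ⊆ H) :
    ¬ Connected vs S H := by
  obtain ⟨j, hj, hne⟩ := Finset.exists_mem_ne (by omega : 1 < S.card) i
  refine not_connected_of_split (T := {i}) hi (by simp) hj (by simpa using hne) ?_
  intro a _ ha b _ _
  rw [Finset.mem_singleton] at ha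
  subst ha
  exact Finset.inter_subset_left.trans h

section Components

variable {c : Finset ι}

theorem components_subset (hc : c ∈ components vs S H) : c ⊆ S := by
  obtain ⟨i, _, rfl⟩ := Finset.mem_image.1 hc
  exact Finset.filter_subset _ _

theorem components_nonempty (hc : c ∈ components vs S H) : c.Nonempty := by
  obtain ⟨i, hi, rfl⟩ := Finset.mem_image.1 hc
  exact ⟨i, Finset.mem_filter.2 ⟨hi, .refl⟩⟩

theorem exists_mem_components {i : ι} (hi : i ∈ S) : ∃ c ∈ components vs S H, i ∈ c :=
  ⟨_, Finset.mem_image_of_mem _ hi, Finset.mem_filter.2 ⟨hi, .refl⟩⟩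

theorem components_closed (hc : c ∈ components vs S H) {i j : ι} (hi : i ∈ c)
    (hl : Linked vs S H i j) : j ∈ c := by
  obtain ⟨k, hk, rfl⟩ := Finset.mem_image.1 hc
  rw [Finset.mem_filter] at hi ⊢
  exact ⟨hl.2.1, hi.2.tail hl⟩

theorem components_inter_subset (hc : c ∈ components vs S H) {i j : ι} (hi : i ∈ c) (hj : j ∈ S)
    (hjc : j ∉ c) {x : V} (hxi : x ∈ vs i) (hxj : x ∈ vs j) : x ∈ H := by
  by_contra hx
  exact hjc (components_closed hc hi ⟨components_subset hc hi, hj, x, by simp [*]⟩)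

theorem components_eq_of_mem {d : Finset ι} (hc : c ∈ components vs S H)
    (hd : d ∈ components vs S H) {i : ι} (hic : i ∈ c) (hid : i ∈ d) : c = d := by
  obtain ⟨k, hk, rfl⟩ := Finset.mem_image.1 hc
  obtain ⟨l, hl, rfl⟩ := Finset.mem_image.1 hd
  rw [Finset.mem_filter] at hic hid
  ext j
  simp only [Finset.mem_filter]
  exact and_congr_right fun _ => ⟨fun h => hid.2.trans ((reflTransGen_linked_symm hic.2).trans h),
    fun h => hic.2.trans ((reflTransGen_linked_symm hid.2).trans h)⟩

theorem components_disjoint {d : Finset ι} (hc : c ∈ components vs S H)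
    (hd : d ∈ components vs S H) (h : c ≠ d) : Disjoint c d :=
  Finset.disjoint_left.2 fun _ hi hj => h (components_eq_of_mem hc hd hi hj)

theorem components_eq_of_mem_varsOf {d : Finset ι} (hc : c ∈ components vs S H)
    (hd : d ∈ components vs S H) {x : V} (hx : x ∉ H) (hxc : x ∈ varsOf vs c)
    (hxd : x ∈ varsOf vs d) : c = d := by
  obtain ⟨i, hi, hxi⟩ := mem_varsOf.1 hxc
  obtain ⟨j, hj, hxj⟩ := mem_varsOf.1 hxd
  by_cases hjc : j ∈ c
  · exact components_eq_of_mem hc hd hjc hj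
  · exact absurd (components_inter_subset hc hi (components_subset hd hj) hjc hxi hxj) hx

/-- Links inside `c` use only variables of `c`, so cutting the head down to these variables changes
no link. -/
theorem components_connected (hc : c ∈ components vs S H) :
    Connected vs c (H ∩ varsOf vs c) := by
  have key : ∀ i ∈ c, ∀ j, Relation.ReflTransGen (Linked vs S H) i j →
      j ∈ c ∧ Relation.ReflTransGen (Linked vs c (H ∩ varsOf vs c)) i j := by
    intro i hi j hij
    induction hij with
    | refl => exact ⟨hi, .refl⟩
    | tail _ hl ih =>
      have hm := components_closed hc ih.1 hl
      exact ⟨hm, ih.2.tail ⟨ih.1, hm, (hl.anti Finset.inter_subset_left).2.2⟩⟩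
  intro i hi j hj
  refine (key i hi j ?_).2
  obtain ⟨k, hk, rfl⟩ := Finset.mem_image.1 hc
  rw [Finset.mem_filter] at hi hj
  exact (reflTransGen_linked_symm hi.2).trans hj.2

theorem components_card_lt (hn : ¬ Connected vs S H) (hc : c ∈ components vs S H) :
    c.card < S.card := by
  refine Finset.card_lt_card ((components_subset hc).ssubset_of_ne ?_)
  intro hcS
  obtain ⟨k, hk, rfl⟩ := Finset.mem_image.1 hc
  rw [Finset.filter_eq_self] at hcS
  exact hn fun i hi j hj => (reflTransGen_linked_symm (hcS i hi)).trans (hcS j hj)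

theorem two_le_card_components (hn : ¬ Connected vs S H) : 2 ≤ (components vs S H).card := by
  obtain ⟨i, hi⟩ : S.Nonempty := by
    rw [Finset.nonempty_iff_ne_empty]
    rintro rfl
    exact hn fun i hi => by simp at hi
  obtain ⟨c, hc, hic⟩ := exists_mem_components (vs := vs) (H := H) hi
  obtain ⟨j, hj, hjc⟩ : ∃ j ∈ S, j ∉ c := by
    by_contra! h
    have := components_card_lt hn hc
    have := Finset.card_le_card (show S ⊆ c from h)
    omega
  obtain ⟨d, hd, hjd⟩ := exists_mem_components (vs := vs) (H := H) hj
  exact Finset.one_lt_card.2 ⟨c, hc, d, hd, fun h => hjc (h ▸ hjd)⟩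

end Components

/-! ### Existence and multiplicity of top sets -/

theorem exists_isTopSet_subset {X : Finset V} (hX : X ⊆ evar vs S H)
    (hn : ¬ Connected vs S (H ∪ X)) : ∃ Y ⊆ X, IsTopSet vs S H Y := by
  obtain ⟨Y, hYX, hY⟩ := exists_minimal_le_of_wellFoundedLT
    (fun Y : Finset V => ¬ Connected vs S (H ∪ Y)) X hn
  refine ⟨Y, hYX, hYX.trans hX, hY.1, fun Y' hY' => ?_⟩
  by_contra hc
  exact hY'.2 (hY.2 hc hY'.1)

theorem IsTopSet.nonempty {Y : Finset V} (hY : IsTopSet vs S H Y) (hc : Connected vs S H) :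
    Y.Nonempty := by
  rw [Finset.nonempty_iff_ne_empty]
  rintro rfl
  exact hY.2.1 (by simpa using hc)

theorem exists_isTopSet (hS : 2 ≤ S.card) : ∃ Y, IsTopSet vs S H Y := by
  obtain ⟨i, hi⟩ : S.Nonempty := Finset.card_pos.1 (by omega)
  obtain ⟨Y, -, hY⟩ := exists_isTopSet_subset (vs := vs) (S := S) (H := H) Finset.Subset.rfl
    (not_connected_of_subset hS hi (fun x hx => by
      by_cases h : x ∈ H
      · simp [h]
      · simp [evar, h, mem_varsOf.2 ⟨i, hi, hx⟩]))
  exact ⟨Y, hY⟩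

/-- If no existential variable occurs in all atoms, then no top set is the only one. -/
theorem exists_isTopSet_ne (hS : 2 ≤ S.card) (hc : Connected vs S H)
    (hz : ∀ x ∈ evar vs S H, ∃ i ∈ S, x ∉ vs i) (Y : Finset V) :
    ∃ Y', Y' ≠ Y ∧ IsTopSet vs S H Y' := by
  by_contra! h
  obtain ⟨Y₀, hY₀⟩ := exists_isTopSet (vs := vs) (H := H) hS
  obtain rfl : Y₀ = Y := by_contra fun hne => h _ hne hY₀
  obtain ⟨x, hx⟩ := hY₀.nonempty hc
  obtain ⟨i, hi, hxi⟩ := hz x (hY₀.1 hx)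
  -- Moving all existential variables of atom `i` to the head isolates it, so some top set lies
  -- inside `vs i`. A unique top set would therefore be contained in every atom.
  obtain ⟨Y', hY'i, hY'⟩ := exists_isTopSet_subset (vs := vs) (S := S) (H := H) (X := vs i \ H)
    (Finset.sdiff_subset_sdiff (fun x hx => mem_varsOf.2 ⟨i, hi, hx⟩) Finset.Subset.rfl)
    (not_connected_of_subset hS hi (fun x hx => by by_cases h : x ∈ H <;> simp [h, hx]))
  obtain rfl : Y' = Y₀ := by_contra fun hne => h _ hne hY'
  exact hxi (Finset.mem_sdiff.1 (hY'i hx)).1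

/-! ### The plan enumeration: existence, and when it branches -/

section Enumeration

variable {det : Set ι}

theorem sepVar_subset_evar : sepVar vs det S H ⊆ evar vs S H := Finset.filter_subset _ _

theorem mem_sepVar {x : V} :
    x ∈ sepVar vs det S H ↔ x ∈ evar vs S H ∧ ∀ i ∈ S, i ∉ det → x ∈ vs i :=
  Finset.mem_filter

theorem card_evar_union_lt {Y : Finset V} (hY : Y ⊆ evar vs S H) (hne : Y.Nonempty) :
    (evar vs S (H ∪ Y)).card < (evar vs S H).card := by
  obtain ⟨x, hx⟩ := hne
  refine Finset.card_lt_card ⟨Finset.sdiff_subset_sdiff Finset.Subset.rfl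
    Finset.subset_union_left, fun h => ?_⟩
  have := h (hY hx)
  simp [evar, hx] at this

/-- The recursive enumeration returns at least one plan. -/
theorem exists_DP (vs : ι → Finset V) (det : Set ι) (S : Finset ι) (hS : S.Nonempty)
    (H : Finset V) : ∃ P, DP vs det S H P := by
  -- Passing to a component lowers the number of atoms; moving variables to the head lowers the
  -- number of existential variables.
  induction hn : S.card + (evar vs S H).card using Nat.strong_induction_on generalizing S H with
  | _ n ih =>
  subst hn
  have ih' : ∀ Y, Y ⊆ evar vs S H → Y.Nonempty → ∃ P, DP vs det S (H ∪ Y) P :=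
    fun Y hY hne => ih _ (by have := card_evar_union_lt hY hne; omega) S hS _ rfl
  by_cases h2 : 2 ≤ S.card
  · by_cases hc : Connected vs S H
    · by_cases hz : sepVar vs det S H = ∅
      · obtain ⟨Y, hY⟩ := exists_isTopSet (vs := vs) (H := H) h2
        obtain ⟨P, hP⟩ := ih' Y hY.1 (hY.nonempty hc)
        exact ⟨_, .top S H Y P h2 hc hz hY hP⟩
      · have hne := Finset.nonempty_iff_ne_empty.2 hz
        by_cases hd : Connected vs S (H ∪ sepVar vs det S H)
        · obtain ⟨Y, hY⟩ := exists_isTopSet (vs := vs) (H := H ∪ sepVar vs det S H) h2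
          obtain ⟨P, hP⟩ := ih' (sepVar vs det S H ∪ Y)
            (Finset.union_subset sepVar_subset_evar (hY.1.trans
              (Finset.sdiff_subset_sdiff Finset.Subset.rfl Finset.subset_union_left)))
            (hne.mono Finset.subset_union_left)
          rw [← Finset.union_assoc] at hP
          exact ⟨_, .separatorTop S H Y P h2 hc hz hd hY hP⟩
        · obtain ⟨P, hP⟩ := ih' _ sepVar_subset_evar hne
          exact ⟨_, .separator S H P h2 hc hz hd hP⟩
    · have : ∀ c : {c // c ∈ components vs S H}, ∃ P, DP vs det c.1 (H ∩ varsOf vs c.1) P := by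
        intro c
        refine ih _ ?_ c.1 (components_nonempty c.2) _ rfl
        have h1 := components_card_lt hc c.2
        have h2 : evar vs c.1 (H ∩ varsOf vs c.1) ⊆ evar vs S H := by
          rw [evar, Finset.sdiff_inter_self_right]
          exact Finset.sdiff_subset_sdiff (varsOf_mono (components_subset c.2)) Finset.Subset.rfl
        have := Finset.card_le_card h2
        omega
      choose f hf using this
      exact ⟨_, .disconnected S H f h2 hc hf⟩
  · obtain ⟨i, rfl⟩ := Finset.card_eq_one.1
      (by have := Finset.card_pos.2 hS; omega : S.card = 1)
    exact ⟨_, .single i H⟩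

/-- The subqueries that the recursion reaches from a query with head variables `H₀`: they contain
all atoms that are connected to them, and no existential variable is a head variable of the
query. -/
structure Admissible (vs : ι → Finset V) (H₀ : Finset V) (S : Finset ι) (H : Finset V) : Prop where
  head : ∀ x ∈ H₀, x ∈ varsOf vs S → x ∈ H
  closed : ∀ i ∈ S, ∀ j ∉ S, ∀ x ∈ vs i, x ∈ vs j → x ∈ H
  subset : H ⊆ varsOf vs S

namespace Admissible

variable {H₀ : Finset V}

theorem union (h : Admissible vs H₀ S H) {Y : Finset V} (hY : Y ⊆ evar vs S H) :
    Admissible vs H₀ S (H ∪ Y) where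
  head x hx hS := Finset.mem_union_left _ (h.head x hx hS)
  closed i hi j hj x hxi hxj := Finset.mem_union_left _ (h.closed i hi j hj x hxi hxj)
  subset := Finset.union_subset h.subset (hY.trans Finset.sdiff_subset)

theorem component (h : Admissible vs H₀ S H) {c : Finset ι} (hc : c ∈ components vs S H) :
    Admissible vs H₀ c (H ∩ varsOf vs c) where
  head x hx hS := Finset.mem_inter.2
    ⟨h.head x hx (varsOf_mono (components_subset hc) hS), hS⟩
  closed i hi j hj x hxi hxj := by
    refine Finset.mem_inter.2 ⟨?_, mem_varsOf.2 ⟨i, hi, hxi⟩⟩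
    by_cases hjS : j ∈ S
    · exact components_inter_subset hc hi hjS hj hxi hxj
    · exact h.closed i (components_subset hc hi) j hjS x hxi hxj
  subset := Finset.inter_subset_right

end Admissible

/-- Since an enumerated plan reveals the head variables of its subquery, different top sets cannot
lead to the same plan. -/
theorem DP.hvar_eq {P : Plan ι V} (hP : DP vs det S H P) (hH : H ⊆ varsOf vs S) :
    P.hvar vs = H := by
  have key : ∀ {S : Finset ι} {H Y : Finset V}, H ⊆ varsOf vs S → Y ⊆ evar vs S H →
      H ∪ Y ⊆ varsOf vs S ∧ (H ∪ Y) \ Y = H := by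
    intro S H Y hH hY
    refine ⟨Finset.union_subset hH (hY.trans Finset.sdiff_subset), ?_⟩
    rw [Finset.union_sdiff_right, Finset.sdiff_eq_self_iff_disjoint]
    exact Finset.disjoint_of_subset_right hY Finset.disjoint_sdiff
  induction hP with
  | single i H => rfl
  | disconnected S H f hS hd hf ih =>
    ext x
    simp only [Plan.hvar, Finset.mem_biUnion, Finset.mem_attach, true_and]
    constructor
    · rintro ⟨c, hx⟩
      rw [ih c Finset.inter_subset_right] at hx
      exact (Finset.mem_inter.1 hx).1
    · intro hx
      obtain ⟨i, hi, hxi⟩ := mem_varsOf.1 (hH hx)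
      obtain ⟨c, hc, hic⟩ := exists_mem_components (vs := vs) (H := H) hi
      refine ⟨⟨c, hc⟩, ?_⟩
      rw [ih _ Finset.inter_subset_right]
      exact Finset.mem_inter.2 ⟨hx, mem_varsOf.2 ⟨i, hic, hxi⟩⟩
  | separator S H P hS hc hz hd hP ih =>
    obtain ⟨h1, h2⟩ := key hH (sepVar_subset_evar (det := det))
    rw [Plan.away, Plan.hvar, ih h1, h2]
  | separatorTop S H Y P hS hc hz hc' hY hP ih =>
    rw [Finset.union_assoc] at ih
    obtain ⟨h1, h2⟩ := key hH (Finset.union_subset (sepVar_subset_evar (det := det)) (hY.1.trans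
              (Finset.sdiff_subset_sdiff Finset.Subset.rfl Finset.subset_union_left)))
    rw [Plan.away, Plan.hvar, ih h1, h2]
  | top S H Y P hS hc hz hY hP ih =>
    obtain ⟨h1, h2⟩ := key hH hY.1
    rw [Plan.away, Plan.hvar, ih h1, h2]

/-- If the separator variables always disconnect a connected subquery, then the enumeration returns
only one plan. -/
theorem DP.unique {H₀ : Finset V}
    (hgood : ∀ S H, Admissible vs H₀ S H → 2 ≤ S.card → Connected vs S H →
      ¬ Connected vs S (H ∪ sepVar vs det S H))
    {P P' : Plan ι V} (hP : DP vs det S H P) (hP' : DP vs det S H P')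
    (hS : Admissible vs H₀ S H) : P' = P := by
  induction hP generalizing P' with
  | single i H =>
    generalize hi : ({i} : Finset ι) = S at hP'
    cases hP' with
    | single j => rw [Finset.singleton_inj.1 hi]
    | _ => subst hi; rw [Finset.card_singleton] at *; omega
  | disconnected S H f h2 hd hf ih =>
    cases hP' with
    | single => simp at h2
    | disconnected _ _ f' _ _ hf' =>
      congr 1
      funext c
      exact ih c (hf' c) (hS.component c.2)
    | _ => contradiction
  | separator S H P h2 hc hz hd hP ih =>
    cases hP' with
    | single => simp at h2
    | separator _ _ P' _ _ _ _ hP' => rw [ih hP' (hS.union sepVar_subset_evar)]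
    | _ => contradiction
  | separatorTop S H Y P h2 hc hz hc' hY hP ih => exact absurd hc' (hgood S H hS h2 hc)
  | top S H Y P h2 hc hz hY hP ih =>
    exact absurd hc (by simpa [hz] using hgood S H hS h2 hc)

/-- The set `Z` stands for the separator variables, or is empty when there are none, so that both
uses of top sets are covered. Both projections have the same target; the plans differ because their
subplans have different head variables. -/
theorem not_unique_of_isTopSet {Z Y : Finset V} (h2 : 2 ≤ S.card) (hH : H ⊆ varsOf vs S)
    (hZ : Z ⊆ evar vs S H) (hc : Connected vs S (H ∪ Z))
    (hz : ∀ x ∈ evar vs S (H ∪ Z), ∃ i ∈ S, x ∉ vs i)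
    (hY : IsTopSet vs S (H ∪ Z) Y) {P : Plan ι V} (hP : DP vs det S (H ∪ Z ∪ Y) P) :
    ∃ Y' P', IsTopSet vs S (H ∪ Z) Y' ∧ DP vs det S (H ∪ Z ∪ Y') P' ∧
      P'.away vs (Z ∪ Y') ≠ P.away vs (Z ∪ Y) := by
  obtain ⟨Y', hne, hY'⟩ := exists_isTopSet_ne h2 hc hz Y
  obtain ⟨P', hP'⟩ := exists_DP vs det S (Finset.card_pos.1 (by omega)) (H ∪ Z ∪ Y')
  have hHZ : H ∪ Z ⊆ varsOf vs S := Finset.union_subset hH (hZ.trans Finset.sdiff_subset)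
  refine ⟨Y', P', hY', hP', fun h => hne ?_⟩
  simp only [Plan.away, Plan.proj.injEq] at h
  have e1 := hP.hvar_eq (Finset.union_subset hHZ (hY.1.trans Finset.sdiff_subset))
  have e2 := hP'.hvar_eq (Finset.union_subset hHZ (hY'.1.trans Finset.sdiff_subset))
  rw [h.2, e1] at e2
  have d1 : Disjoint (H ∪ Z) Y := Finset.disjoint_of_subset_right hY.1 Finset.disjoint_sdiff
  have d2 : Disjoint (H ∪ Z) Y' := Finset.disjoint_of_subset_right hY'.1 Finset.disjoint_sdiff
  rw [← Finset.union_sdiff_cancel_left d1, ← Finset.union_sdiff_cancel_left d2, e2]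

end Enumeration

end Incidence

/-! ### Product measures on subsets of a finite set -/

section Probability

variable {τ : Type*} (T : Finset τ) (p : τ → ℝ)

/-- The probability of the event `E` in a random subset of `T` that contains every `t ∈ T`
independently with probability `p t`. -/
def eventProb (E : Finset τ → Prop) : ℝ :=
  ∑ W ∈ T.powerset with E W, (∏ t ∈ W, p t) * ∏ t ∈ T \ W, (1 - p t)

variable {T p}

theorem eventProb_eq_sum_ite (E : Finset τ → Prop) : eventProb T p E =
    ∑ W ∈ T.powerset, if E W then (∏ t ∈ W, p t) * ∏ t ∈ T \ W, (1 - p t) else 0 :=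
  Finset.sum_filter _ _

/-- Conditioning on whether `t` is present; this recursion drives the inductions on `T` below. -/
theorem eventProb_insert {t : τ} (ht : t ∉ T) (E : Finset τ → Prop) :
    eventProb (insert t T) p E =
      (1 - p t) * eventProb T p E + p t * eventProb T p (fun W => E (insert t W)) := by
  simp only [eventProb_eq_sum_ite]
  rw [Finset.sum_powerset_insert ht, Finset.mul_sum, Finset.mul_sum]
  congr 1
  · refine Finset.sum_congr rfl fun W hW => ?_
    have htW : t ∉ W := fun h => ht (Finset.mem_powerset.1 hW h)
    rw [Finset.insert_sdiff_of_notMem _ htW, Finset.prod_insert (by simp [ht])]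
    split_ifs <;> ring
  · refine Finset.sum_congr rfl fun W hW => ?_
    have htW : t ∉ W := fun h => ht (Finset.mem_powerset.1 hW h)
    rw [Finset.insert_sdiff_insert, Finset.sdiff_insert_of_notMem ht, Finset.prod_insert htW]
    split_ifs <;> ring

theorem eventProb_empty (E : Finset τ → Prop) :
    eventProb ∅ p E = if E ∅ then 1 else 0 := by
  simp [eventProb_eq_sum_ite]

theorem eventProb_mono (h0 : ∀ t ∈ T, 0 ≤ p t) (h1 : ∀ t ∈ T, p t ≤ 1)
    {E F : Finset τ → Prop} (h : ∀ W ⊆ T, E W → F W) :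
    eventProb T p E ≤ eventProb T p F := by
  refine Finset.sum_le_sum_of_subset_of_nonneg (fun W hW => Finset.mem_filter.2
    ⟨(Finset.mem_filter.1 hW).1, h W (Finset.mem_powerset.1 (Finset.mem_filter.1 hW).1)
      (Finset.mem_filter.1 hW).2⟩) fun W hW _ => ?_
  have hW := Finset.mem_powerset.1 (Finset.mem_filter.1 hW).1
  exact mul_nonneg (Finset.prod_nonneg fun t ht => h0 t (hW ht))
    (Finset.prod_nonneg fun t ht => sub_nonneg.2 (h1 t (Finset.mem_sdiff.1 ht).1))

theorem eventProb_true : eventProb T p (fun _ => True) = 1 := by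
  induction T using Finset.induction_on with
  | empty => simp [eventProb_empty]
  | insert t T ht ih => rw [eventProb_insert ht, ih]; ring

theorem eventProb_not (E : Finset τ → Prop) :
    eventProb T p (fun W => ¬ E W) = 1 - eventProb T p E := by
  induction T using Finset.induction_on generalizing E with
  | empty => by_cases h : E ∅ <;> simp [eventProb_empty, h]
  | insert t T ht ih => rw [eventProb_insert ht, eventProb_insert ht, ih, ih]; ring

theorem eventProb_mem {t : τ} (ht : t ∈ T) : eventProb T p (fun W => t ∈ W) = p t := by
  obtain ⟨T, hT, rfl⟩ : ∃ T', t ∉ T' ∧ insert t T' = T :=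
    ⟨T.erase t, Finset.notMem_erase _ _, Finset.insert_erase ht⟩
  rw [eventProb_insert hT]
  have h : eventProb T p (fun W => t ∈ W) = 0 := by
    rw [eventProb_eq_sum_ite]
    exact Finset.sum_eq_zero fun W hW => if_neg fun htW => hT (Finset.mem_powerset.1 hW htW)
  simp [h, eventProb_true]

/-- Elements of probability `1` may be assumed to be present. -/
theorem eventProb_congr {E F : Finset τ → Prop}
    (h : ∀ W ⊆ T, (∀ t ∈ T, p t = 1 → t ∈ W) → (E W ↔ F W)) :
    eventProb T p E = eventProb T p F := by
  simp only [eventProb_eq_sum_ite]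
  refine Finset.sum_congr rfl fun W hW => ?_
  by_cases hd : ∀ t ∈ T, p t = 1 → t ∈ W
  · simp only [h W (Finset.mem_powerset.1 hW) hd]
  · push Not at hd
    obtain ⟨t, ht, hpt, htW⟩ := hd
    have : ∏ t ∈ T \ W, (1 - p t) = 0 :=
      Finset.prod_eq_zero (Finset.mem_sdiff.2 ⟨ht, htW⟩) (by rw [hpt, sub_self])
    simp [this]

/-- The event `E` depends only on the elements of `K`. -/
def EventOn (K : Set τ) (E : Finset τ → Prop) : Prop :=
  ∀ W W' : Finset τ, (∀ t ∈ K, t ∈ W ↔ t ∈ W') → (E W ↔ E W')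

theorem EventOn.comp_insert {K : Set τ} {E : Finset τ → Prop} (h : EventOn K E) (t : τ) :
    EventOn K (fun W => E (insert t W)) :=
  fun W W' hW => h _ _ fun s hs => by simp [hW s hs]

theorem EventOn.insert_iff {K : Set τ} {E : Finset τ → Prop} (h : EventOn K E) {t : τ}
    (ht : t ∉ K) (W : Finset τ) : E (insert t W) ↔ E W :=
  h _ _ fun s hs => by
    have : s ≠ t := fun e => ht (e ▸ hs)
    simp [this]

/-- When conditioning on one element `t`, at most one of the two events notices it, and the other
factors out. -/
theorem eventProb_and {K L : Set τ} {E F : Finset τ → Prop} (hE : EventOn K E) (hF : EventOn L F)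
    (hKL : Disjoint K L) :
    eventProb T p (fun W => E W ∧ F W) = eventProb T p E * eventProb T p F := by
  induction T using Finset.induction_on generalizing E F with
  | empty => by_cases h : E ∅ <;> by_cases h' : F ∅ <;> simp [eventProb_empty, h, h']
  | insert t T ht ih =>
    rw [eventProb_insert ht, eventProb_insert ht, eventProb_insert ht, ih hE hF,
      ih (hE.comp_insert t) (hF.comp_insert t)]
    by_cases hK : t ∈ K
    · simp only [hF.insert_iff (Set.disjoint_left.1 hKL hK)]
      ring
    · simp only [hE.insert_iff hK]
      ring

theorem eventProb_forall {α : Type*} (s : Finset α) {K : α → Set τ} {E : α → Finset τ → Prop}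
    (hE : ∀ a ∈ s, EventOn (K a) (E a))
    (hK : ∀ a ∈ s, ∀ b ∈ s, a ≠ b → Disjoint (K a) (K b)) :
    eventProb T p (fun W => ∀ a ∈ s, E a W) = ∏ a ∈ s, eventProb T p (E a) := by
  induction s using Finset.induction_on with
  | empty => simp [eventProb_true]
  | insert a s ha ih =>
    have h : EventOn (⋃ b ∈ s, K b) (fun W => ∀ b ∈ s, E b W) := fun W W' hW =>
      forall₂_congr fun b hb => hE b (Finset.mem_insert_of_mem hb) _ _ fun t ht =>
        hW t (Set.mem_biUnion (Finset.mem_coe.2 hb) ht)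
    rw [Finset.prod_insert ha, ← ih (fun b hb => hE b (Finset.mem_insert_of_mem hb))
      (fun b hb c hc => hK b (Finset.mem_insert_of_mem hb) c (Finset.mem_insert_of_mem hc)),
      ← eventProb_and (hE a (Finset.mem_insert_self _ _)) h]
    · simp only [Finset.forall_mem_insert]
    · rw [Set.disjoint_iUnion₂_right]
      exact fun b hb => hK a (Finset.mem_insert_self _ _) b (Finset.mem_insert_of_mem hb)
        fun e => ha (e ▸ hb)

/-- The independent-or. -/
theorem eventProb_exists {α : Type*} (s : Finset α) {K : α → Set τ} {E : α → Finset τ → Prop}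
    (hE : ∀ a ∈ s, EventOn (K a) (E a))
    (hK : ∀ a ∈ s, ∀ b ∈ s, a ≠ b → Disjoint (K a) (K b)) :
    eventProb T p (fun W => ∃ a ∈ s, E a W) = 1 - ∏ a ∈ s, (1 - eventProb T p (E a)) := by
  have h := eventProb_forall (T := T) (p := p) s (E := fun a W => ¬ E a W) (K := K)
    (fun a ha W W' hW => not_congr (hE a ha W W' hW)) hK
  simp only [eventProb_not] at h
  rw [← h, ← eventProb_not]
  simp

end Probability

/-! ### Groundings, dissociated variables and functional dependencies -/

namespace SJFQuery

variable {ι V D : Type*} {q : SJFQuery ι V D}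

theorem mem_vars {i : ι} {x : V} : x ∈ q.vars i ↔ ∃ k, q.args i k = Sum.inl x := by
  simp only [vars, Finset.mem_biUnion, Finset.mem_univ, true_and]
  refine exists_congr fun k => ?_
  cases h : q.args i k <;> simp [eq_comm]

theorem ground_eq_iff {i : ι} {θ θ' : V → D} :
    q.ground i θ = q.ground i θ' ↔ ∀ x ∈ q.vars i, θ x = θ' x := by
  simp only [ground, Sigma.mk.injEq, heq_eq_eq, true_and, funext_iff]
  constructor
  · intro h x hx
    obtain ⟨k, hk⟩ := mem_vars.1 hx
    simpa [hk] using h k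
  · intro h k
    cases hk : q.args i k with
    | inl x => exact h x (mem_vars.2 ⟨k, hk⟩)
    | inr d => rfl

theorem mem_adom {B : q.Database} {i : ι} {θ : V → D} (h : q.ground i θ ∈ B.tuples) {x : V}
    (hx : x ∈ q.vars i) : θ x ∈ B.adom := by
  obtain ⟨k, hk⟩ := mem_vars.1 hx
  refine Finset.mem_biUnion.2 ⟨_, h, Finset.mem_image.2 ⟨k, Finset.mem_univ _, ?_⟩⟩
  simp [ground, hk]

theorem mem_fdVars [Fintype ι] {σ : q.Schema} {i : ι} {x : V} :
    x ∈ q.fdVars σ i ↔ (∃ j, x ∈ q.vars j) ∧ q.FDVar σ i x := by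
  simp [fdVars, mem_varsOf]

theorem vars_subset_fdVars [Fintype ι] {σ : q.Schema} {i : ι} : q.vars i ⊆ q.fdVars σ i :=
  fun x hx => mem_fdVars.2 ⟨⟨i, hx⟩, .base x hx⟩

theorem varsOf_subset_varsOf_fdVars [Fintype ι] {σ : q.Schema} {S : Finset ι} :
    varsOf q.vars S ⊆ varsOf (q.fdVars σ) S :=
  Finset.biUnion_mono fun _ _ => vars_subset_fdVars

theorem head_subset_varsOf [Fintype ι] : q.head ⊆ varsOf q.vars Finset.univ := fun x hx => by
  obtain ⟨i, k, hk⟩ := q.head_occurs x hx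
  exact mem_varsOf.2 ⟨i, Finset.mem_univ _, mem_vars.2 ⟨k, hk⟩⟩

theorem admissible_univ [Fintype ι] {σ : q.Schema} :
    Admissible (q.fdVars σ) q.head Finset.univ q.head where
  head _ hx _ := hx
  closed _ _ j hj := absurd (Finset.mem_univ j) hj
  subset := head_subset_varsOf.trans varsOf_subset_varsOf_fdVars

/-- Dissociation adds only variables of other atoms. If the original atom of `x` were outside `S`,
closedness would make `x` a head variable. Hence a plan over the undissociated atoms can also
project `x` away. -/
theorem _root_.Dissociation.Admissible.mem_varsOf_vars [Fintype ι] {σ : q.Schema} {S : Finset ι}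
    {H : Finset V} (h : Admissible (q.fdVars σ) q.head S H) {x : V}
    (hx : x ∈ evar (q.fdVars σ) S H) : x ∈ varsOf q.vars S := by
  obtain ⟨hx, hxH⟩ := Finset.mem_sdiff.1 hx
  obtain ⟨i, hi, hxi⟩ := mem_varsOf.1 hx
  obtain ⟨⟨j, hj⟩, -⟩ := mem_fdVars.1 hxi
  refine mem_varsOf.2 ⟨j, ?_, hj⟩
  by_contra hjS
  exact hxH (h.closed i hi j hjS x hxi (vars_subset_fdVars hj))

/-- The query restricted to the atoms in `S` is true in the world `W`, for given values of the
variables in `H`. -/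
def HoldsOn (q : SJFQuery ι V D) (S : Finset ι) (H : Finset V) (a : V → D)
    (W : Finset q.Tuple) : Prop :=
  ∃ θ : V → D, (∀ x ∈ H, θ x = a x) ∧ ∀ i ∈ S, q.ground i θ ∈ W

/-- A subquery is true in a world with the tuples of the deterministic relations if its
grounding consists of possible tuples and the tuples of the probabilistic relations are
present. -/
theorem holdsOn_iff {σ : q.Schema} {S : Finset ι} {H : Finset V} {B : q.Database}
    (hB : B.Conforms σ) {W : Finset q.Tuple} (hW : W ⊆ B.tuples)
    (hW1 : ∀ t ∈ B.tuples, B.prob t = 1 → t ∈ W) (a : V → D) :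
    q.HoldsOn S H a W ↔ ∃ θ : V → D, (∀ x ∈ H, θ x = a x) ∧
      ∀ i ∈ S, q.ground i θ ∈ B.tuples ∧ (i ∉ σ.det → q.ground i θ ∈ W) := by
  refine exists_congr fun θ => and_congr_right fun _ => forall₂_congr fun i _ => ?_
  refine ⟨fun h => ⟨hW h, fun _ => h⟩, fun h => ?_⟩
  by_cases hi : i ∈ σ.det
  · exact hW1 _ h.1 (hB.1 _ h.1 hi)
  · exact h.2 hi

theorem reliability_eq [Fintype ι] (B : q.Database) (a : V → D) :
    q.reliability B a = eventProb B.tuples B.prob (q.HoldsOn Finset.univ q.head a) := by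
  have h : q.HoldsOn Finset.univ q.head a = q.Holds a := by
    funext W
    simp [HoldsOn, Holds]
  rw [h]
  unfold reliability eventProb Database.worldProb
  congr!

theorem score_proj (B : q.Database) {X Y : Finset V} {P : Plan ι V}
    (h : P.hvar q.vars \ X = Y) (θ : V → D) : q.score B (.proj X P) θ =
      1 - ∏ u ∈ Fintype.piFinset fun _ : {x // x ∈ Y} => B.adom,
        (1 - q.score B P (Function.updateFinset θ Y u)) := by
  subst h
  rfl

/-- In a conforming database, the dissociated variables of an atom are determined by the
variables of the atom and the head variables. -/
theorem eq_of_fdVar [Fintype ι] {σ : q.Schema} {B : q.Database} (hB : B.Conforms σ)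
    {S : Finset ι} {H : Finset V} (hS : Admissible (q.fdVars σ) q.head S H) {i : ι} (hi : i ∈ S)
    {θ θ' : V → D} (hH : ∀ x ∈ H, θ x = θ' x) (hv : ∀ x ∈ q.vars i, θ x = θ' x)
    (hθ : ∀ j ∈ S, q.ground j θ ∈ B.tuples) (hθ' : ∀ j ∈ S, q.ground j θ' ∈ B.tuples)
    {x : V} (hx : q.FDVar σ i x) : θ x = θ' x := by
  induction hx with
  | base x hx => exact hv x hx
  | step k Γ hΓ hY z hz ih =>
    by_cases hzH : z ∈ H
    · exact hH z hzH
    have hzk := σ.fds_right k Γ hΓ hz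
    -- A dependency on an atom outside `S` gives no information about `θ` and `θ'`, but closedness
    -- then puts `z` into `H`.
    have hk : k ∈ S := by
      by_contra hk
      exact hzH (hS.closed i hi k hk z (mem_fdVars.2 ⟨⟨k, hzk⟩, .step k Γ hΓ hY z hz⟩)
        (vars_subset_fdVars hzk))
    refine hB.2 k Γ hΓ θ θ' (hθ k hk) (hθ' k hk) (fun y hy => ?_) z hz
    by_cases hyh : y ∈ q.head
    · exact hH y (hS.head y hyh
        (mem_varsOf.2 ⟨k, hk, vars_subset_fdVars (σ.fds_left k Γ hΓ hy)⟩))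
    · exact ih y hy hyh

/-! ### Exact plans from an enumeration without branching -/

/-- `P` is a well-formed plan for the subquery with atoms `S` and head variables `H`, and it
calculates the reliability of this subquery over all conforming databases. -/
structure Evaluates [Fintype ι] (q : SJFQuery ι V D) (σ : q.Schema) (S : Finset ι) (H : Finset V)
    (P : Plan ι V) : Prop where
  wellFormed : P.WellFormed q.vars
  rels_eq : P.rels = S
  -- The plan reads the original tables, so head variables that entered `S` only by dissociation are
  -- not in its output. The next two fields carry the alternation of joins and projections through
  -- the recursion.
  hvar_eq : P.hvar q.vars = H ∩ varsOf q.vars S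
  not_isJoin : Connected (q.fdVars σ) S H → ¬ P.IsJoin
  not_isProj : ¬ Connected (q.fdVars σ) S H → ¬ P.IsProj
  away_le_one : ∀ y, P.awayCount q.vars y ≤ 1
  away_head : ∀ y ∈ H, P.awayCount q.vars y = 0
  away_not_mem : ∀ y ∉ varsOf (q.fdVars σ) S, P.awayCount q.vars y = 0
  score_eq : ∀ B : q.Database, B.Conforms σ → ∀ a : V → D,
    q.score B P a = eventProb B.tuples B.prob (q.HoldsOn S H a)

namespace Evaluates

variable [Fintype ι] {σ : q.Schema} {S : Finset ι} {H : Finset V}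

theorem isPlan {P : Plan ι V} (h : Evaluates q σ Finset.univ q.head P) : q.IsPlan P where
  wellFormed := h.wellFormed
  rels_eq := h.rels_eq
  hvar_eq := by rw [h.hvar_eq, Finset.inter_eq_left.2 head_subset_varsOf]
  away_le_one := h.away_le_one
  away_head := h.away_head

section Projection

variable {s : Finset V}

/-- The events for different values `u` of `s` are independent: the tuples of deterministic
relations are certain and can be dropped, and a probabilistic tuple taking part in a possible
grounding determines `u`. -/
theorem eventProb_holdsOn_eq (hS : Admissible (q.fdVars σ) q.head S H)
    (hs : s ⊆ evar (q.fdVars σ) S H)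
    (hsep : ∀ i ∈ S, i ∉ σ.det → s ⊆ q.fdVars σ i) {B : q.Database} (hB : B.Conforms σ)
    (a : V → D) : eventProb B.tuples B.prob (q.HoldsOn S H a) =
      1 - ∏ u ∈ Fintype.piFinset fun _ : {x // x ∈ s} => B.adom,
        (1 - eventProb B.tuples B.prob
          (q.HoldsOn S (H ∪ s) (Function.updateFinset a s u))) := by
  have hsH : ∀ x ∈ H, x ∉ s := fun x hx hxs => (Finset.mem_sdiff.1 (hs hxs)).2 hx
  rw [Finset.prod_congr rfl fun u _ => congrArg (1 - ·)
    (eventProb_congr fun W hW hW1 => holdsOn_iff hB hW hW1 (Function.updateFinset a s u)),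
    ← eventProb_exists (E := fun (u : {x // x ∈ s} → D) W => ∃ θ : V → D,
      (∀ x ∈ H ∪ s, θ x = Function.updateFinset a s u x) ∧
      ∀ i ∈ S, q.ground i θ ∈ B.tuples ∧ (i ∉ σ.det → q.ground i θ ∈ W))
      -- Only probabilistic tuples in groundings consisting of possible tuples are collected. The
      -- functional dependencies are known only for such groundings, and disjointness rests on them.
      (K := fun u => {t | ∃ θ : V → D, ∃ i ∈ S, i ∉ σ.det ∧ t = q.ground i θ ∧
      (∀ x ∈ H ∪ s, θ x = Function.updateFinset a s u x) ∧
      ∀ j ∈ S, q.ground j θ ∈ B.tuples})]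
  · refine eventProb_congr fun W hW hW1 => ?_
    rw [holdsOn_iff hB hW hW1]
    constructor
    · rintro ⟨θ, hθ, h⟩
      refine ⟨fun x => θ x, Fintype.mem_piFinset.2 fun x => ?_, θ, fun x hx => ?_, h⟩
      · obtain ⟨i, hi, hxi⟩ := mem_varsOf.1 (hS.mem_varsOf_vars (hs x.2))
        exact mem_adom (h i hi).1 hxi
      · by_cases hxs : x ∈ s
        · simp [Function.updateFinset, hxs]
        · simpa [Function.updateFinset, hxs] using
            hθ x ((Finset.mem_union.1 hx).resolve_right hxs)
    · rintro ⟨u, -, θ, hθ, h⟩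
      refine ⟨θ, fun x hx => ?_, h⟩
      simpa [Function.updateFinset, hsH x hx] using hθ x (Finset.mem_union_left _ hx)
  · intro u _ W W' hW
    refine exists_congr fun θ => and_congr_right fun hθ => ?_
    constructor
    · exact fun h i hi => ⟨(h i hi).1, fun hd =>
        (hW _ ⟨θ, i, hi, hd, rfl, hθ, fun j hj => (h j hj).1⟩).1 ((h i hi).2 hd)⟩
    · exact fun h i hi => ⟨(h i hi).1, fun hd =>
        (hW _ ⟨θ, i, hi, hd, rfl, hθ, fun j hj => (h j hj).1⟩).2 ((h i hi).2 hd)⟩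
  · intro u _ u' _ hne
    rw [Set.disjoint_left]
    rintro _ ⟨θ, i, hi, hd, rfl, hθ, hT⟩ ⟨θ', i', -, -, he, hθ', hT'⟩
    obtain rfl : i = i' := congrArg Sigma.fst he
    refine hne (funext fun x => ?_)
    have h1 := hθ x (Finset.mem_union_right _ x.2)
    have h2 := hθ' x (Finset.mem_union_right _ x.2)
    have h3 : θ x = θ' x := by
      refine eq_of_fdVar hB hS hi (fun y hy => ?_) (ground_eq_iff.1 he) hT hT'
        (mem_fdVars.1 (hsep i hi hd x.2)).2
      rw [hθ y (Finset.mem_union_left _ hy), hθ' y (Finset.mem_union_left _ hy)]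
      simp [Function.updateFinset, hsH y hy]
    simpa [Function.updateFinset, h1, h2] using h3

theorem proj (hS : Admissible (q.fdVars σ) q.head S H) (hs : s ⊆ evar (q.fdVars σ) S H)
    (hsep : ∀ i ∈ S, i ∉ σ.det → s ⊆ q.fdVars σ i)
    (hc : Connected (q.fdVars σ) S H) (hP : ∃ P, Evaluates q σ S (H ∪ s) P ∧ ¬ P.IsProj) :
    ∃ P, Evaluates q σ S H P := by
  obtain ⟨P, hP, hproj⟩ := hP
  have hsV : s ⊆ varsOf q.vars S := fun x hx => hS.mem_varsOf_vars (hs hx)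
  have hsH : Disjoint s H := Finset.disjoint_left.2 fun x hx => (Finset.mem_sdiff.1 (hs hx)).2
  have hY : P.hvar q.vars \ (H ∩ varsOf q.vars S) = s := by
    rw [hP.hvar_eq]
    ext x
    have h1 := @hsV x
    have h2 : x ∈ s → x ∉ H := fun h => Finset.disjoint_left.1 hsH h
    simp only [Finset.mem_sdiff, Finset.mem_inter, Finset.mem_union]
    tauto
  refine ⟨.proj (H ∩ varsOf q.vars S) P, ⟨?_, hproj, hP.wellFormed⟩, hP.rels_eq, rfl,
    fun _ h => h, fun h => absurd hc h, fun y => ?_, fun y hy => ?_, fun y hy => ?_,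
    fun B hB a => ?_⟩
  · rw [hP.hvar_eq]
    exact Finset.inter_subset_inter_right Finset.subset_union_left
  · rw [Plan.awayCount, hY]
    split_ifs with h
    · rw [hP.away_head y (Finset.mem_union_right _ h)]
    · exact hP.away_le_one y
  · rw [Plan.awayCount, hY, hP.away_head y (Finset.mem_union_left _ hy),
      if_neg (Finset.disjoint_right.1 hsH hy)]
  · rw [Plan.awayCount, hY, hP.away_not_mem y hy,
      if_neg fun h => hy (varsOf_subset_varsOf_fdVars (hsV h))]
  · rw [score_proj B hY, eventProb_holdsOn_eq hS hs hsep hB]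
    simp only [hP.score_eq B hB]

end Projection

/-- With all variables of the atom in the head, truth is the presence of a single tuple. -/
theorem atom (i : ι) : Evaluates q σ {i} (q.vars i ∪ H) (.atom i) where
  wellFormed := trivial
  rels_eq := rfl
  hvar_eq := by simp [Plan.hvar, varsOf]
  not_isJoin _ := id
  not_isProj _ := id
  away_le_one _ := zero_le_one
  away_head _ _ := rfl
  away_not_mem _ _ := rfl
  score_eq B _ a := by
    have h : ∀ W, q.HoldsOn {i} (q.vars i ∪ H) a W ↔ q.ground i a ∈ W := by
      intro W
      constructor
      · rintro ⟨θ, hθ, h⟩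
        rw [← ground_eq_iff.2 fun x hx => hθ x (Finset.mem_union_left _ hx)]
        exact h i (Finset.mem_singleton_self i)
      · exact fun h => ⟨a, fun _ _ => rfl, fun j hj => by rwa [Finset.mem_singleton.1 hj]⟩
    rw [eventProb_congr fun W _ _ => h W, score]
    split_ifs with ht
    · exact (eventProb_mem ht).symm
    · rw [eventProb_congr (F := fun _ => False) fun W hW _ => iff_false_intro fun h => ht (hW h)]
      simp [eventProb]

theorem join (h2 : ¬ Connected (q.fdVars σ) S H)
    (f : {c // c ∈ components (q.fdVars σ) S H} → Plan ι V)
    (hf : ∀ c, Evaluates q σ c.1 (H ∩ varsOf (q.fdVars σ) c.1) (f c)) :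
    Evaluates q σ S H (.join (components (q.fdVars σ) S H) f) where
  wellFormed := ⟨two_le_card_components h2, fun c hc d hd h => components_disjoint hc hd h,
    fun c => ⟨(hf c).rels_eq, (hf c).not_isJoin (components_connected c.2), (hf c).wellFormed⟩⟩
  rels_eq := by
    ext i
    simp only [Plan.rels, Finset.mem_biUnion, Finset.mem_attach, true_and, (hf _).rels_eq]
    constructor
    · rintro ⟨c, hc⟩
      exact components_subset c.2 hc
    · intro hi
      obtain ⟨c, hc, hic⟩ := exists_mem_components hi
      exact ⟨⟨c, hc⟩, hic⟩
  hvar_eq := by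
    ext x
    simp only [Plan.hvar, Finset.mem_biUnion, Finset.mem_attach, true_and, (hf _).hvar_eq,
      Finset.mem_inter]
    constructor
    · rintro ⟨c, ⟨hx, -⟩, hxc⟩
      exact ⟨hx, varsOf_mono (components_subset c.2) hxc⟩
    · rintro ⟨hx, hxS⟩
      obtain ⟨i, hi, hxi⟩ := mem_varsOf.1 hxS
      obtain ⟨c, hc, hic⟩ := exists_mem_components (vs := q.fdVars σ) (H := H) hi
      have hxc : x ∈ varsOf q.vars c := mem_varsOf.2 ⟨i, hic, hxi⟩
      exact ⟨⟨c, hc⟩, ⟨hx, varsOf_subset_varsOf_fdVars hxc⟩, hxc⟩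
  not_isJoin h := absurd h h2
  not_isProj _ := id
  away_le_one y := by
    rw [Plan.awayCount]
    by_cases hy : ∃ c : {c // c ∈ components (q.fdVars σ) S H},
        (f c).awayCount q.vars y ≠ 0
    · obtain ⟨c, hc⟩ := hy
      rw [Finset.sum_eq_single c]
      · exact (hf c).away_le_one y
      · intro d _ hdc
        by_contra hd
        -- A variable projected away in a component is existential and occurs there, and an
        -- existential variable occurs in only one component.
        have key : ∀ e, (f e).awayCount q.vars y ≠ 0 → y ∈ varsOf (q.fdVars σ) e.1 ∧ y ∉ H := by
          intro e he
          have hye := by_contra fun h => he ((hf e).away_not_mem y h)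
          exact ⟨hye, fun hyH => he ((hf e).away_head y (Finset.mem_inter.2 ⟨hyH, hye⟩))⟩
        exact hdc (Subtype.ext (components_eq_of_mem_varsOf d.2 c.2 (key c hc).2 (key d hd).1
          (key c hc).1))
      · exact fun h => absurd (Finset.mem_attach _ _) h
    · push Not at hy
      rw [Finset.sum_eq_zero fun c _ => hy c]
      exact zero_le_one
  away_head y hy := by
    rw [Plan.awayCount]
    refine Finset.sum_eq_zero fun c _ => ?_
    by_cases hyc : y ∈ varsOf (q.fdVars σ) c.1
    · exact (hf c).away_head y (Finset.mem_inter.2 ⟨hy, hyc⟩)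
    · exact (hf c).away_not_mem y hyc
  away_not_mem y hy := by
    rw [Plan.awayCount]
    exact Finset.sum_eq_zero fun c _ =>
      (hf c).away_not_mem y fun h => hy (varsOf_mono (components_subset c.2) h)
  score_eq B hB a := by
    rw [score, Finset.prod_congr rfl fun c _ => (hf c).score_eq B hB a,
      ← eventProb_forall
        (E := fun c : {c // c ∈ components (q.fdVars σ) S H} =>
          q.HoldsOn c.1 (H ∩ varsOf (q.fdVars σ) c.1) a)
        (K := fun c => {t : q.Tuple | t.1 ∈ c.1})]
    · refine eventProb_congr fun W _ _ => ?_
      constructor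
      · intro h
        choose θ hθ using fun c => h c (Finset.mem_attach _ c)
        -- The valuations of the components are glued together: each variable outside `H` takes its
        -- value from the only component that contains it.
        let η : V → D := fun x =>
          if hx : ∃ c : {c // c ∈ components (q.fdVars σ) S H},
            x ∉ H ∧ x ∈ varsOf (q.fdVars σ) c.1 then θ hx.choose x else a x
        refine ⟨η, fun x hx => dif_neg fun h => h.choose_spec.1 hx, fun i hi => ?_⟩
        obtain ⟨c, hc, hic⟩ := exists_mem_components (vs := q.fdVars σ) (H := H) hi
        rw [(ground_eq_iff (θ' := θ ⟨c, hc⟩)).2]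
        · exact (hθ ⟨c, hc⟩).2 i hic
        · intro x hx
          have hxc : x ∈ varsOf (q.fdVars σ) c := mem_varsOf.2 ⟨i, hic, vars_subset_fdVars hx⟩
          by_cases hxH : x ∈ H
          · rw [(hθ ⟨c, hc⟩).1 x (Finset.mem_inter.2 ⟨hxH, hxc⟩)]
            exact dif_neg fun h => h.choose_spec.1 hxH
          · have hex : ∃ c : {c // c ∈ components (q.fdVars σ) S H},
              x ∉ H ∧ x ∈ varsOf (q.fdVars σ) c.1 := ⟨⟨c, hc⟩, hxH, hxc⟩
            have : hex.choose = ⟨c, hc⟩ := Subtype.ext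
              (components_eq_of_mem_varsOf hex.choose.2 hc hxH hex.choose_spec.2 hxc)
            simp only [η, dif_pos hex, this]
      · rintro ⟨θ, hθ, h⟩ c -
        exact ⟨θ, fun x hx => hθ x (Finset.mem_inter.1 hx).1,
          fun i hi => h i (components_subset c.2 hi)⟩
    · intro c _ W W' hW
      exact exists_congr fun θ => and_congr_right fun _ => forall₂_congr fun i hi =>
        hW (q.ground i θ) hi
    · intro c _ d _ hne
      exact Set.disjoint_left.2 fun t hc hd => hne (Subtype.ext
        (components_eq_of_mem c.2 d.2 hc hd))

end Evaluates

/-- If the plan enumeration returns only one plan, then the query can be evaluated by a plan. -/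
theorem exists_evaluates [Fintype ι] {σ : q.Schema} {S : Finset ι} {H : Finset V} {P : Plan ι V}
    (hP : DP (q.fdVars σ) σ.det S H P)
    (huniq : ∀ P', DP (q.fdVars σ) σ.det S H P' → P' = P)
    (hS : Admissible (q.fdVars σ) q.head S H) : ∃ P', Evaluates q σ S H P' := by
  induction hP with
  | single i H =>
    -- Only the original variables of the atom are projected away; those added by dissociation do
    -- not occur in its table.
    refine Evaluates.proj hS (s := q.vars i \ H)
      (Finset.sdiff_subset_sdiff (fun x hx => ?_) Finset.Subset.rfl) (fun j hj _ => ?_)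
      (connected_singleton i) ⟨.atom i, ?_, id⟩
    · exact mem_varsOf.2 ⟨i, Finset.mem_singleton_self i, vars_subset_fdVars hx⟩
    · rw [Finset.mem_singleton.1 hj]
      exact Finset.sdiff_subset.trans vars_subset_fdVars
    · rw [Finset.union_sdiff_self_eq_union, Finset.union_comm]
      exact Evaluates.atom i
  | disconnected S H f h2 hd hf ih =>
    have : ∀ c : {c // c ∈ components (q.fdVars σ) S H},
        ∃ P', Evaluates q σ c.1 (H ∩ varsOf (q.fdVars σ) c.1) P' := by
      intro c
      refine ih c (fun P' hP' => ?_) (hS.component c.2)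
      -- Uniqueness passes to a component: exchanging one subplan of the join gives another
      -- enumerated plan.
      have h := huniq _ (.disconnected S H (Function.update f c P') h2 hd fun d => ?_)
      · simp only [Plan.join.injEq, heq_eq_eq, true_and] at h
        rw [← congrFun h c, Function.update_self]
      · by_cases hdc : d = c
        · subst hdc
          rwa [Function.update_self]
        · rw [Function.update_of_ne hdc]
          exact hf d
    choose g hg using this
    exact ⟨_, Evaluates.join hd g hg⟩
  | separator S H P h2 hc hz hd hP ih =>
    have hsub := (sepVar_subset_evar (vs := q.fdVars σ) (det := σ.det) (S := S) (H := H))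
    have hS' := hS.union hsub
    obtain ⟨P₁, hP₁⟩ := ih (fun P' hP' => by
      have h := huniq _ (.separator S H P' h2 hc hz hd hP')
      simp only [Plan.away, Plan.proj.injEq] at h
      exact h.2) hS'
    exact Evaluates.proj hS hsub
      (fun i hi hid x hx => (mem_sepVar.1 hx).2 i hi hid) hc ⟨P₁, hP₁, hP₁.not_isProj hd⟩
  | separatorTop S H Y P h2 hc hz hc' hY hP ih =>
    obtain ⟨Y', P', hY', hP', hne⟩ := not_unique_of_isTopSet h2 hS.subset
      (sepVar_subset_evar (det := σ.det)) hc' (fun x hx => by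
        by_contra! h
        obtain ⟨hx, hn⟩ := Finset.mem_sdiff.1 hx
        rw [Finset.mem_union, not_or] at hn
        exact hn.2 (mem_sepVar.2 ⟨Finset.mem_sdiff.2 ⟨hx, hn.1⟩, fun i hi _ => h i hi⟩))
      hY hP
    exact absurd (huniq _ (.separatorTop S H Y' P' h2 hc hz hc' hY' hP')) hne
  | top S H Y P h2 hc hz hY hP ih =>
    obtain ⟨Y', P', hY', hP', hne⟩ := not_unique_of_isTopSet (Z := ∅) h2 hS.subset
      (Finset.empty_subset _) (by simpa using hc) (fun x hx => by
        rw [Finset.union_empty] at hx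
        by_contra! h
        have : x ∈ sepVar (q.fdVars σ) σ.det S H := mem_sepVar.2 ⟨hx, fun i hi _ => h i hi⟩
        simp [hz] at this)
      (by simpa using hY) (by simpa using hP)
    rw [Finset.union_empty] at hY' hP'
    rw [Finset.empty_union, Finset.empty_union] at hne
    exact absurd (huniq _ (.top S H Y' P' h2 hc hz hY' hP')) hne

end SJFQuery

/-! ### Lower bounds for scores -/

theorem prod_le_prod_of_subset_of_le_one {α : Type*} {s t : Finset α} {f : α → ℝ} (hst : s ⊆ t)
    (h0 : ∀ a ∈ t, 0 ≤ f a) (h1 : ∀ a ∈ t, f a ≤ 1) : ∏ a ∈ t, f a ≤ ∏ a ∈ s, f a := by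
  rw [← Finset.prod_sdiff hst]
  refine mul_le_of_le_one_left (Finset.prod_nonneg fun a ha => h0 a (hst ha)) ?_
  exact Finset.prod_le_one (fun a ha => h0 a (Finset.sdiff_subset ha))
    fun a ha => h1 a (Finset.sdiff_subset ha)

namespace Plan

variable {ι V : Type*}

/-- All projections above the atom `i` are applied to subplans whose head variables are in `A`. -/
def Within (vs : ι → Finset V) (i : ι) (A : Set V) : Plan ι V → Prop
  | atom _ => True
  | proj _ P => (i ∈ P.rels → ∀ x ∈ P.hvar vs, x ∈ A) ∧ P.Within vs i A
  | join _ f => ∀ c, (f c).Within vs i A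

variable {vs : ι → Finset V}

theorem within_of_not_mem {i : ι} {A : Set V} {P : Plan ι V} (hi : i ∉ P.rels) :
    P.Within vs i A := by
  induction P with
  | atom j => trivial
  | proj X P ih => exact ⟨fun h => absurd h hi, ih hi⟩
  | join cs f ih =>
    exact fun c => ih c fun h => hi (Finset.mem_biUnion.2 ⟨c, Finset.mem_attach _ _, h⟩)

theorem WellFormed.hvar_subset {P : Plan ι V} (hP : P.WellFormed vs) :
    P.hvar vs ⊆ varsOf vs P.rels := by
  induction P with
  | atom j => simp [hvar, rels, varsOf]
  | proj X P ih => exact hP.1.trans (ih hP.2.2)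
  | join cs f ih =>
    intro x hx
    obtain ⟨c, hc, hx⟩ := Finset.mem_biUnion.1 hx
    exact varsOf_mono (Finset.subset_biUnion_of_mem (fun c => (f c).rels) hc)
      (ih c (hP.2.2 c).2.2 hx)

theorem mem_hvar_or_awayCount_ne_zero {P : Plan ι V} {j : ι} (hj : j ∈ P.rels) {y : V}
    (hy : y ∈ vs j) : y ∈ P.hvar vs ∨ P.awayCount vs y ≠ 0 := by
  induction P with
  | atom i =>
    rw [rels, Finset.mem_singleton] at hj
    exact .inl (hj ▸ hy)
  | proj X P ih =>
    by_cases hX : y ∈ X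
    · exact .inl hX
    right
    rw [awayCount]
    rcases ih hj with h | h
    · simp [h, hX]
    · omega
  | join cs f ih =>
    obtain ⟨c, hc, hj⟩ := Finset.mem_biUnion.1 hj
    rcases ih c hj with h | h
    · exact .inl (Finset.mem_biUnion.2 ⟨c, hc, h⟩)
    · right
      rw [awayCount, Ne, Finset.sum_eq_zero_iff]
      exact fun h0 => h (h0 c hc)

end Plan

namespace SJFQuery

variable {ι V D : Type*} {q : SJFQuery ι V D}

section Score

variable {B : q.Database}

theorem score_mem_Icc (P : Plan ι V) (θ : V → D) : q.score B P θ ∈ Set.Icc (0 : ℝ) 1 := by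
  induction P generalizing θ with
  | atom i =>
    rw [score]
    split_ifs with h
    · exact ⟨B.prob_nonneg _ h, B.prob_le_one _ h⟩
    · exact ⟨le_rfl, zero_le_one⟩
  | proj X P ih =>
    rw [score]
    constructor
    · exact sub_nonneg.2 (Finset.prod_le_one (fun u _ => sub_nonneg.2 (ih _).2)
        fun u _ => sub_le_self _ (ih _).1)
    · exact sub_le_self _ (Finset.prod_nonneg fun u _ => sub_nonneg.2 (ih _).2)
  | join cs f ih =>
    exact ⟨Finset.prod_nonneg fun c _ => (ih c θ).1,
      Finset.prod_le_one (fun c _ => (ih c θ).1) fun c _ => (ih c θ).2⟩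

theorem score_congr {P : Plan ι V} {θ θ' : V → D} (h : ∀ x ∈ P.hvar q.vars, θ x = θ' x) :
    q.score B P θ = q.score B P θ' := by
  induction P generalizing θ θ' with
  | atom i => rw [score, score, ground_eq_iff.2 h]
  | proj X P ih =>
    rw [score, score]
    congr 1
    refine Finset.prod_congr rfl fun u _ => ?_
    rw [ih fun x hx => ?_]
    by_cases hX : x ∈ X
    · simp [Function.updateFinset, hX, h x hX]
    · simp [Function.updateFinset, hX, hx]
  | join cs f ih =>
    exact Finset.prod_congr rfl fun c hc =>
      ih c fun x hx => h x (Finset.mem_biUnion.2 ⟨c, hc, hx⟩)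

/-- All factors of the product lie in [0,1], so keeping only those in `U` can only enlarge it. -/
theorem le_score_proj {X : Finset V} {P : Plan ι V} {θ : V → D}
    {U : Finset ({x // x ∈ P.hvar q.vars \ X} → D)} (hU : ∀ u ∈ U, ∀ x, u x ∈ B.adom) :
    1 - ∏ u ∈ U, (1 - q.score B P (Function.updateFinset θ (P.hvar q.vars \ X) u)) ≤
      q.score B (.proj X P) θ := by
  rw [score]
  exact sub_le_sub_left (prod_le_prod_of_subset_of_le_one
    (fun u hu => Fintype.mem_piFinset.2 (hU u hu))
    (fun u _ => sub_nonneg.2 (score_mem_Icc _ _).2)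
    fun u _ => sub_le_self _ (score_mem_Icc _ _).1) _

theorem score_le_score_proj {X : Finset V} {P : Plan ι V} {θ : V → D}
    (hθ : ∀ x ∈ P.hvar q.vars, θ x ∈ B.adom) : q.score B P θ ≤ q.score B (.proj X P) θ := by
  have h := le_score_proj (B := B) (X := X) (P := P) (θ := θ) (U := {fun x => θ x.1})
    (fun u hu x => by
      rw [Finset.mem_singleton.1 hu]
      exact hθ x (Finset.mem_sdiff.1 x.2).1)
  have he : Function.updateFinset θ (P.hvar q.vars \ X) (fun x => θ x.1) = θ := by
    funext x
    simp [Function.updateFinset]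
  rwa [Finset.prod_singleton, he, sub_sub_cancel] at h

theorem le_score_join {cs : Finset (Finset ι)} {f : {c // c ∈ cs} → Plan ι V} {θ : V → D}
    (c : {c // c ∈ cs}) (h : ∀ d, d ≠ c → 1 ≤ q.score B (f d) θ) :
    q.score B (f c) θ ≤ q.score B (.join cs f) θ := by
  rw [score, ← Finset.mul_prod_erase _ _ (Finset.mem_attach cs c)]
  refine le_mul_of_one_le_right (score_mem_Icc _ _).1 ?_
  calc (1 : ℝ) = ∏ d ∈ cs.attach.erase c, 1 := by simp
    _ ≤ _ := Finset.prod_le_prod (fun _ _ => zero_le_one) fun d hd =>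
      h d (Finset.mem_erase.1 hd).1

end Score

/-! ### The database that defeats a wrong projection -/

section Witness

variable {i : ι} {A : Set V} {d d' : D}

/-- The valuation that separates the variables outside of `A` from those in `A`. -/
def splitVal (A : Set V) (d d' : D) (x : V) : D := if x ∈ A then d else d'

variable [Fintype ι]

/-- The database of the tuples required by a constant valuation and by a valuation that differs
from it outside of `A`, in which only the tuples of the relation `i` are uncertain. -/
def splitDatabase (q : SJFQuery ι V D) (i : ι) (A : Set V) (d d' : D) : q.Database where
  tuples := Finset.univ.image (fun j => q.ground j fun _ => d) ∪
    Finset.univ.image (fun j => q.ground j (splitVal A d d'))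
  prob t := if t.1 = i then 1 / 2 else 1
  prob_nonneg t _ := by split_ifs <;> norm_num
  prob_le_one t _ := by split_ifs <;> norm_num

theorem ground_mem_splitDatabase {j : ι} {θ : V → D} :
    q.ground j θ ∈ (q.splitDatabase i A d d').tuples ↔
      (∀ x ∈ q.vars j, θ x = d) ∨ ∀ x ∈ q.vars j, θ x = splitVal A d d' x := by
  have key : ∀ θ' : V → D, (∃ k, q.ground k θ' = q.ground j θ) ↔
      ∀ x ∈ q.vars j, θ x = θ' x := by
    intro θ'
    rw [← ground_eq_iff]
    constructor
    · rintro ⟨k, hk⟩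
      obtain rfl : k = j := congrArg Sigma.fst hk
      exact hk.symm
    · exact fun h => ⟨j, h.symm⟩
  simp only [splitDatabase, Finset.mem_union, Finset.mem_image, Finset.mem_univ, true_and, key]

/-- Since `d ≠ d'`, the two groundings agree exactly on `A`. A dependency could fail only between
them, and closedness of `A` under the dependencies excludes this. -/
theorem splitDatabase_conforms {σ : q.Schema} (hi : i ∉ σ.det) (hd : d ≠ d')
    (hA : ∀ j, ∀ Γ ∈ σ.fds j, (∀ y ∈ Γ.1, y ∈ A) → ∀ z ∈ Γ.2, z ∈ A) :
    (q.splitDatabase i A d d').Conforms σ := by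
  refine ⟨fun t _ ht => if_neg fun h : t.1 = i => hi (h ▸ ht), fun j Γ hΓ θ θ' hθ hθ' hY z hz => ?_⟩
  have hl := σ.fds_left j Γ hΓ
  have hzj := σ.fds_right j Γ hΓ hz
  have key : (∀ y ∈ Γ.1, splitVal A d d' y = d) → splitVal A d d' z = d := fun h =>
    if_pos (hA j Γ hΓ (fun y hy => by
      by_contra hyA
      have := h y hy
      rw [splitVal, if_neg hyA] at this
      exact hd this.symm) z hz)
  rw [ground_mem_splitDatabase] at hθ hθ'
  rcases hθ with hθ | hθ <;> rcases hθ' with hθ' | hθ' <;> rw [hθ z hzj, hθ' z hzj]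
  · exact (key fun y hy => by rw [← hθ' y (hl hy), ← hY y hy, hθ y (hl hy)]).symm
  · exact key fun y hy => by rw [← hθ y (hl hy), hY y hy, hθ' y (hl hy)]

/-- Both groundings use the same tuple of relation `i`, so the query cannot be true without this one
coin flip. -/
theorem reliability_splitDatabase_le (hi : ∀ x ∈ q.vars i, x ∈ A) (a : V → D) :
    q.reliability (q.splitDatabase i A d d') a ≤ 1 / 2 := by
  have hm : q.ground i (fun _ => d) ∈ (q.splitDatabase i A d d').tuples :=
    ground_mem_splitDatabase.2 (.inl fun _ _ => rfl)
  have hp := eventProb_mem (p := (q.splitDatabase i A d d').prob) hm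
  rw [show (q.splitDatabase i A d d').prob (q.ground i fun _ => d) = 1 / 2 from if_pos rfl] at hp
  rw [reliability_eq, ← hp]
  refine eventProb_mono (Database.prob_nonneg _) (Database.prob_le_one _) fun W hW => ?_
  rintro ⟨θ, -, h⟩
  have hθ := h i (Finset.mem_univ i)
  rwa [(ground_eq_iff (θ' := fun _ => d)).2] at hθ
  rcases ground_mem_splitDatabase.1 (hW hθ) with h | h
  · exact h
  · exact fun x hx => (h x hx).trans (if_pos (hi x hx))

variable {P : Plan ι V}

theorem mem_adom_splitDatabase (hP : P.WellFormed q.vars) {e : V → D}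
    (he : ∀ j, q.ground j e ∈ (q.splitDatabase i A d d').tuples) {x : V}
    (hx : x ∈ P.hvar q.vars) : e x ∈ (q.splitDatabase i A d d').adom := by
  obtain ⟨j, -, hj⟩ := mem_varsOf.1 (hP.hvar_subset hx)
  exact mem_adom (he j) hj

/-- Following one grounding `e` through the plan, the only possible loss is the factor 1/2 at the
leaf `i`, which occurs in at most one branch of each join; projections do not lower the score. -/
theorem score_splitDatabase_ge (hP : P.WellFormed q.vars) {e : V → D}
    (he : ∀ j, q.ground j e ∈ (q.splitDatabase i A d d').tuples) :
    1 / 2 ≤ q.score (q.splitDatabase i A d d') P e ∧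
      (i ∉ P.rels → 1 ≤ q.score (q.splitDatabase i A d d') P e) := by
  induction P with
  | atom j =>
    rw [score, if_pos (he j)]
    by_cases hj : j = i
    · simp [splitDatabase, ground, hj, Plan.rels]
    · simp only [splitDatabase, ground, hj, if_false]
      norm_num
  | proj X P ih =>
    have h := score_le_score_proj (X := X) fun x hx => mem_adom_splitDatabase hP.2.2 he hx
    obtain ⟨h1, h2⟩ := ih hP.2.2
    exact ⟨h1.trans h, fun hi => (h2 hi).trans h⟩
  | join cs f ih =>
    have ih' := fun c => ih c (hP.2.2 c).2.2
    have hne : cs.Nonempty := Finset.card_pos.1 (by have := hP.1; omega)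
    by_cases hi : ∃ c, i ∈ (f c).rels
    · obtain ⟨c, hc⟩ := hi
      refine ⟨(ih' c).1.trans (le_score_join c fun d hdc => (ih' d).2 fun hd => ?_),
        fun h => absurd (Finset.mem_biUnion.2 ⟨c, Finset.mem_attach _ _, hc⟩) h⟩
      rw [(hP.2.2 _).1] at hc hd
      exact Finset.disjoint_left.1 (hP.2.1 d d.2 c c.2 fun h => hdc (Subtype.ext h)) hd hc
    · push Not at hi
      obtain ⟨c, hc⟩ := hne
      have h := ((ih' ⟨c, hc⟩).2 (hi _)).trans (le_score_join ⟨c, hc⟩ fun d _ => (ih' d).2 (hi d))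
      exact ⟨le_trans (by norm_num) h, fun _ => h⟩

/-- Descending towards `i`, one meets a projection onto variables in `A` whose subplan has a head
variable outside `A`. There the two groundings give distinct tuples with the same projection, each
of score at least 1/2, and the independent-or is at least 1 - (1/2)² = 3/4. -/
theorem score_splitDatabase_ge_of_not_within (hP : P.WellFormed q.vars) (hd : d ≠ d')
    (hA : ∀ x ∈ P.hvar q.vars, x ∈ A) (hw : ¬ P.Within q.vars i A) :
    3 / 4 ≤ q.score (q.splitDatabase i A d d') P fun _ => d := by
  have he : ∀ j, q.ground j (fun _ => d) ∈ (q.splitDatabase i A d d').tuples :=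
    fun j => ground_mem_splitDatabase.2 (.inl fun _ _ => rfl)
  have he' : ∀ j, q.ground j (splitVal A d d') ∈ (q.splitDatabase i A d d').tuples :=
    fun j => ground_mem_splitDatabase.2 (.inr fun _ _ => rfl)
  induction P with
  | atom j => exact absurd trivial hw
  | proj X P ih =>
    by_cases hPA : ∀ x ∈ P.hvar q.vars, x ∈ A
    · exact (ih hP.2.2 hPA fun h => hw ⟨fun _ => hPA, h⟩).trans
        (score_le_score_proj fun x hx => mem_adom_splitDatabase hP.2.2 he hx)
    · push Not at hPA
      obtain ⟨y, hy, hyA⟩ := hPA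
      have hyX : y ∉ X := fun h => hyA (hA y h)
      set u : {x // x ∈ P.hvar q.vars \ X} → D := fun _ => d
      set u' : {x // x ∈ P.hvar q.vars \ X} → D := fun x => splitVal A d d' x
      have hne : u ≠ u' := fun h => by
        have := congrFun h ⟨y, Finset.mem_sdiff.2 ⟨hy, hyX⟩⟩
        simp only [u, u', splitVal, if_neg hyA] at this
        exact hd this
      refine le_trans ?_ (le_score_proj (U := {u, u'}) fun v hv x => ?_)
      · rw [Finset.prod_pair hne]
        have h1 : q.score (q.splitDatabase i A d d') P
            (Function.updateFinset (fun _ => d) (P.hvar q.vars \ X) u) =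
            q.score (q.splitDatabase i A d d') P fun _ => d :=
          score_congr fun x _ => by simp [Function.updateFinset, u]
        have h2 : q.score (q.splitDatabase i A d d') P
            (Function.updateFinset (fun _ => d) (P.hvar q.vars \ X) u') =
            q.score (q.splitDatabase i A d d') P (splitVal A d d') :=
          score_congr fun x hx => by
            by_cases hxX : x ∈ X
            · simp [Function.updateFinset, hxX, splitVal, hA x hxX]
            · simp [Function.updateFinset, hxX, hx, u']
        rw [h1, h2]
        have h3 := (score_splitDatabase_ge hP.2.2 he).1
        have h4 := (score_splitDatabase_ge hP.2.2 he').1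
        nlinarith [mul_le_mul (sub_le_sub_left h3 1) (sub_le_sub_left h4 1)
          (sub_nonneg.2 (score_mem_Icc _ _).2) (by norm_num)]
      · have hx := (Finset.mem_sdiff.1 x.2).1
        rcases Finset.mem_insert.1 hv with rfl | hv
        · exact mem_adom_splitDatabase hP.2.2 he hx
        · rw [Finset.mem_singleton.1 hv]
          exact mem_adom_splitDatabase hP.2.2 he' hx
  | join cs f ih =>
    obtain ⟨c, hc⟩ : ∃ c, ¬ (f c).Within q.vars i A := not_forall.1 hw
    have hic : i ∈ (f c).rels := by_contra fun h => hc (Plan.within_of_not_mem h)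
    refine (ih c (hP.2.2 c).2.2 (fun x hx => hA x
      (Finset.mem_biUnion.2 ⟨c, Finset.mem_attach _ _, hx⟩)) hc).trans
      (le_score_join c fun e hec => (score_splitDatabase_ge (hP.2.2 e).2.2 he).2 fun hie => ?_)
    rw [(hP.2.2 _).1] at hic hie
    exact Finset.disjoint_left.1 (hP.2.1 e e.2 c c.2 fun h => hec (Subtype.ext h)) hie hic

end Witness

/-! ### Structure of an exact plan -/

/-- The variables that are determined by those of the atom `i` and the head variables. -/
def determined (q : SJFQuery ι V D) (σ : q.Schema) (i : ι) : Set V :=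
  {x | x ∈ q.head ∨ q.FDVar σ i x}

theorem determined_closed {σ : q.Schema} {i j : ι} {Γ : Finset V × Finset V} (hΓ : Γ ∈ σ.fds j)
    (hY : ∀ y ∈ Γ.1, y ∈ q.determined σ i) {z : V} (hz : z ∈ Γ.2) : z ∈ q.determined σ i :=
  .inr (.step j Γ hΓ (fun y hy hyh => (hY y hy).resolve_left hyh) z hz)

/-- An exact plan only projects variables away that are determined by the probabilistic atoms
below the projection. -/
theorem within_of_exact [Fintype ι] [Nontrivial D] {σ : q.Schema} {P : Plan ι V}
    (hP : q.IsPlan P) (hex : ∀ B : q.Database, B.Conforms σ →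
      ∀ a : V → D, q.score B P a = q.reliability B a) {i : ι} (hi : i ∉ σ.det) :
    P.Within q.vars i (q.determined σ i) := by
  by_contra hw
  obtain ⟨d, d', hd⟩ := exists_pair_ne D
  have h1 := score_splitDatabase_ge_of_not_within hP.wellFormed hd
    -- At the root the head variables of the plan are those of the query, which count as determined.
    (fun x hx => .inl (hP.hvar_eq ▸ hx)) hw
  rw [hex _ (splitDatabase_conforms hi hd fun j Γ hΓ hY z hz => determined_closed hΓ hY hz)] at h1
  have h2 := reliability_splitDatabase_le (d := d) (d' := d') (A := q.determined σ i)
    (fun x hx => .inr (.base x hx)) fun _ => d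
  linarith

/-- The lowest join that mentions all atoms in `S` splits them; a variable that is determined by
atoms on both sides is determined by all probabilistic atoms. -/
theorem exists_split {σ : q.Schema} {S : Finset ι} (hS2 : 2 ≤ S.card) {P : Plan ι V}
    (hP : P.WellFormed q.vars) (hS : S ⊆ P.rels) (hle : ∀ y, P.awayCount q.vars y ≤ 1)
    (hhead : ∀ y ∈ P.hvar q.vars, P.awayCount q.vars y = 0)
    (hloc : ∀ y, P.awayCount q.vars y ≠ 0 → ∀ j, y ∈ q.vars j → j ∈ P.rels)
    (hw : ∀ i ∈ S, i ∉ σ.det → P.Within q.vars i (q.determined σ i))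
    (hA : ∀ i ∈ S, i ∉ σ.det → ∀ x ∈ P.hvar q.vars, x ∈ q.determined σ i) :
    ∃ T : Finset ι, (∃ i ∈ S, i ∈ T) ∧ (∃ j ∈ S, j ∉ T) ∧
      ∀ i ∈ S, i ∈ T → ∀ j ∈ S, j ∉ T → ∀ x, q.FDVar σ i x → q.FDVar σ j x →
        ∀ k ∈ S, k ∉ σ.det → x ∈ q.determined σ k := by
  induction P with
  | atom i =>
    have := Finset.card_le_card hS
    rw [Plan.rels, Finset.card_singleton] at this
    omega
  | proj X P ih =>
    have hc : ∀ y, P.awayCount q.vars y ≤ (Plan.proj X P).awayCount q.vars y :=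
      fun y => Nat.le_add_right _ _
    refine ih hP.2.2 hS (fun y => (hc y).trans (hle y)) (fun y hy => ?_)
      (fun y hy => hloc y fun h => hy (Nat.le_zero.1 (h ▸ hc y))) (fun i hi hid => (hw i hi hid).2)
      (fun i hi hid => (hw i hi hid).1 (hS hi))
    by_cases hX : y ∈ X
    · exact Nat.le_zero.1 ((hc y).trans (hhead y hX).le)
    -- This projection is the only one allowed to remove `y`, so none below it does.
    · have := hle y
      rw [Plan.awayCount, if_pos (Finset.mem_sdiff.2 ⟨hy, hX⟩)] at this
      omega
  | join cs f ih =>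
    have hc : ∀ c y, (f c).awayCount q.vars y ≤ (Plan.join cs f).awayCount q.vars y := fun c y =>
      Finset.single_le_sum (f := fun c => (f c).awayCount q.vars y) (fun _ _ => Nat.zero_le _)
        (Finset.mem_attach cs c)
    have hv : ∀ c, ∀ y ∈ (f c).hvar q.vars, y ∈ (Plan.join cs f).hvar q.vars := fun c y hy =>
      Finset.mem_biUnion.2 ⟨c, Finset.mem_attach cs c, hy⟩
    have hone : ∀ c d y, (f c).awayCount q.vars y ≠ 0 → (f d).awayCount q.vars y ≠ 0 →
        c = d := by
      intro c d y h h'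
      by_contra hne
      have h1 : (f c).awayCount q.vars y + (f d).awayCount q.vars y ≤ 1 := by
        refine le_trans ?_ (hle y)
        rw [← Finset.sum_pair (f := fun c => (f c).awayCount q.vars y) hne]
        exact Finset.sum_le_sum_of_subset fun _ _ => Finset.mem_attach _ _
      omega
    -- If `f c` projects `y` away, no other branch can contain an atom with `y`: there `y` would
    -- remain visible and reach the output of the join, or be projected away a second time.
    have hlc : ∀ c y, (f c).awayCount q.vars y ≠ 0 → ∀ j, y ∈ q.vars j → j ∈ (f c).rels := by
      intro c y hy j hj
      have h0 : (Plan.join cs f).awayCount q.vars y ≠ 0 := fun h => hy (Nat.le_zero.1 (h ▸ hc c y))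
      obtain ⟨d, -, hjd⟩ := Finset.mem_biUnion.1 (hloc y h0 j hj)
      rcases Plan.mem_hvar_or_awayCount_ne_zero hjd hj with h | h
      · exact absurd (hhead y (hv d y h)) h0
      · rwa [hone c d y hy h]
    by_cases hsub : ∃ c, S ⊆ (f c).rels
    · obtain ⟨c, hSc⟩ := hsub
      exact ih c (hP.2.2 c).2.2 hSc (fun y => (hc c y).trans (hle y))
        (fun y hy => Nat.le_zero.1 ((hc c y).trans (hhead y (hv c y hy)).le)) (hlc c)
        (fun i hi hid => hw i hi hid c) (fun i hi hid x hx => hA i hi hid x (hv c x hx))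
    · push Not at hsub
      -- A dissociated variable of an atom below `c` is determined by all probabilistic atoms of
      -- `S`, unless `f c` projects it away. Two branches cannot both project it away, so for a
      -- variable shared by both sides the first alternative holds.
      have key : ∀ c, ∀ i ∈ (f c).rels, ∀ x, q.FDVar σ i x →
          (∀ k ∈ S, k ∉ σ.det → x ∈ q.determined σ k) ∨ (f c).awayCount q.vars x ≠ 0 := by
        have hvar : ∀ c, ∀ i ∈ (f c).rels, ∀ x ∈ q.vars i,
            (∀ k ∈ S, k ∉ σ.det → x ∈ q.determined σ k) ∨ (f c).awayCount q.vars x ≠ 0 :=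
          fun c i hi x hx => (Plan.mem_hvar_or_awayCount_ne_zero hi hx).imp_left
            fun h k hk hkd => hA k hk hkd x (hv c x h)
        intro c i hi x hx
        induction hx with
        | base x hx => exact hvar c i hi x hx
        | step l Γ hΓ hY z hz ihY =>
          by_cases hl : l ∈ (f c).rels
          · exact hvar c l hl z (σ.fds_right l Γ hΓ hz)
          -- The dependency belongs to an atom outside this branch, so the branch does not project
          -- its left-hand variables away. They are thus determined, and so is `z`.
          · refine .inl fun k hk hkd => determined_closed hΓ (fun y hy => ?_) hz
            by_cases hyh : y ∈ q.head
            · exact .inl hyh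
            · exact (ihY y hy hyh).resolve_right
                (fun h => hl (hlc c y h l (σ.fds_left l Γ hΓ hy))) k hk hkd
      obtain ⟨i, hi⟩ : S.Nonempty := Finset.card_pos.1 (by omega)
      obtain ⟨c, -, hic⟩ := Finset.mem_biUnion.1 (hS hi)
      obtain ⟨j, hj, hjc⟩ := Finset.not_subset.1 (hsub c)
      refine ⟨(f c).rels, ⟨i, hi, hic⟩, ⟨j, hj, hjc⟩, fun a ha hac b hb hbc x hxa hxb => ?_⟩
      obtain ⟨d, -, hbd⟩ := Finset.mem_biUnion.1 (hS hb)
      rcases key c a hac x hxa with h | h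
      · exact h
      · refine (key d b hbd x hxb).resolve_right fun h' => hbc ?_
        rwa [hone c d x h h']

/-- The sides of the lowest join above `S` in the exact plan share only variables of `H` and
variables determined by every probabilistic atom of `S`; the latter, if not in `H`, are separator
variables. -/
theorem not_connected_sepVar [Fintype ι] [Nontrivial D] {σ : q.Schema} {P : Plan ι V}
    (hP : q.IsPlan P) (hex : ∀ B : q.Database, B.Conforms σ →
      ∀ a : V → D, q.score B P a = q.reliability B a) {S : Finset ι} {H : Finset V}
    (hS : Admissible (q.fdVars σ) q.head S H) (h2 : 2 ≤ S.card) :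
    ¬ Connected (q.fdVars σ) S (H ∪ sepVar (q.fdVars σ) σ.det S H) := by
  obtain ⟨T, ⟨i, hi, hiT⟩, ⟨j, hj, hjT⟩, hT⟩ := exists_split (σ := σ) h2 hP.wellFormed
    (hP.rels_eq ▸ Finset.subset_univ S) hP.away_le_one
    (fun y hy => hP.away_head y (hP.hvar_eq ▸ hy))
    (fun _ _ j _ => hP.rels_eq ▸ Finset.mem_univ j)
    (fun _ _ hid => within_of_exact hP hex hid)
    (fun _ _ _ x hx => .inl (hP.hvar_eq ▸ hx))
  refine not_connected_of_split hi hiT hj hjT fun a ha haT b hb hbT x hx => ?_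
  obtain ⟨hxa, hxb⟩ := Finset.mem_inter.1 hx
  have hxS : x ∈ varsOf (q.fdVars σ) S := mem_varsOf.2 ⟨a, ha, hxa⟩
  by_cases hxH : x ∈ H
  · exact Finset.mem_union_left _ hxH
  refine Finset.mem_union_right _ (mem_sepVar.2 ⟨Finset.mem_sdiff.2 ⟨hxS, hxH⟩, fun k hk hkd => ?_⟩)
  refine mem_fdVars.2 ⟨(mem_fdVars.1 hxa).1, ?_⟩
  exact (hT a ha haT b hb hbT x (mem_fdVars.1 hxa).2 (mem_fdVars.1 hxb).2 k hk hkd).resolve_left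
    fun h => hxH (hS.head x h hxS)

end SJFQuery

end Dissociation

end

/-- Dichotomy: a self-join-free conjunctive query `q` with schema knowledge `σ` is safe if and only
if the plan enumeration returns exactly one plan. -/
theorem mainTheorem10 {ι V D : Type*} [Fintype ι] [Nonempty ι] [Infinite D]
    (q : Dissociation.SJFQuery ι V D) (σ : q.Schema) :
    q.IsSafe σ ↔ ∃! P : Dissociation.Plan ι V, P ∈ q.plansFP σ := by
  constructor
  · rintro ⟨P, hP, hex⟩
    obtain ⟨P₀, hP₀⟩ := Dissociation.exists_DP (q.fdVars σ) σ.det Finset.univ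
      Finset.univ_nonempty q.head
    exact ⟨P₀, hP₀, fun P' hP' => hP₀.unique
      (fun _ _ hS h2 _ => Dissociation.SJFQuery.not_connected_sepVar hP hex hS h2) hP'
      Dissociation.SJFQuery.admissible_univ⟩
  · rintro ⟨P, hP, huniq⟩
    obtain ⟨P', hP'⟩ := Dissociation.SJFQuery.exists_evaluates hP huniq
      Dissociation.SJFQuery.admissible_univ
    exact ⟨P', hP'.isPlan, fun B hB a => by
      rw [hP'.score_eq B hB, Dissociation.SJFQuery.reliability_eq]⟩
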